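/- Notation. All graphs are finite and simple. For a graph $G$, $\lambda(G)$ is the largest eigenvalue of its adjacency matrix and $\Delta(G)$ its maximum degree; $G_1\vee G_2$ is the join (the disjoint union together with all edges between $G_1$ and $G_2$). For a graph $T$, $\mathrm{spex}(n,T)$ is the maximum of $\lambda(G)$ over all $n$-vertex graphs $G$ that contain no copy of $T$ as a (not necessarily induced) subgraph, and $\mathrm{SPEX}(n,T)$ is the set of $n$-vertex graphs without a copy of $T$ with $\lambda(G)=\mathrm{spex}(n,T)$. For integers $m,l,\delta\ge 0$, write $T\in\mathcal T_{m,l+1}^{\delta}$ if $T$ is a tree on $m$ vertices with bipartition $\{A,B\}$, $l+1=|A|\le|B|$, and $\delta=\min\{d_T(v):v\in A\}$. For $0\le l\le n$ and real $d$ let $$f(d,n)=\frac{l+d-1+\sqrt{(l+d-1)^2+4(nl+d-ld-l^2)}}{2},$$ which is the largest root of the characteristic polynomial of $\begin{bmatrix} l-1& n-l\\ l& d\end{bmatrix}$. Theorem. Let $T\in\mathcal T_{m,l+1}^{\delta}$. Then there exists $N\in\mathbb N$ such that for all $n>N$ the following hold. 1. If $G\in\mathrm{SPEX}(n,T)$,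 then $G\cong H_1\vee H_2$, where $H_1$ is a graph on $l$ vertices and $H_2$ is a graph on $n-l$ vertices with $\Delta(H_2)\le\delta-1$. 2. If $G\in\mathrm{SPEX}(n,T)$ and $G'=K_l\vee H_2'$, where $H_2'$ is any graph on $n-l$ vertices with $\Delta(H_2')\le\delta-1$ in which at most one vertex has degree $\delta-1$, then $\lambda(G)\ge\lambda(G')$. 3. $\mathrm{spex}(n,T)\le f(\delta-1,n)$, and if $\delta\ge 2$, then also $f(\delta-2,n)\le\mathrm{spex}(n,T)$. -/

import Mathlib

open scoped Classical

namespace SpectralTuran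

/-- `T` is a tree of order `m` with bipartition `{A, Aᶜ}`, where the smaller part `A` has `l + 1`
vertices and the minimum degree in `T` of the vertices of `A` is `δ`. The bipartition of a tree is
unique; when both parts have the same size, either of them may serve as `A` (and then `δ = 1`). -/
structure InTreeFamily {W : Type*} [Fintype W] (T : SimpleGraph W) (m l δ : ℕ) : Prop where
  isTree : T.IsTree
  card_eq : Fintype.card W = m
  exists_smaller_part : ∃ A : Finset W,
    T.IsBipartiteWith (A : Set W) ((Aᶜ : Finset W) : Set W) ∧
    A.card = l + 1 ∧ A.card ≤ Aᶜ.card ∧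
    IsLeast {d : ℕ | ∃ v ∈ A, T.degree v = d} δ

/-- The spectral radius `λ(G)`: the largest (real) eigenvalue of the adjacency matrix of `G`. -/
noncomputable def lambda {V : Type*} [Fintype V] (G : SimpleGraph V) : ℝ :=
  sSup {μ : ℝ | Module.End.HasEigenvalue (Matrix.toLin' (G.adjMatrix ℝ)) μ}

/-- `spex(n, T)`: the maximum spectral radius over all `n`-vertex graphs that contain no copy
of `T` as a (not necessarily induced) subgraph. -/
noncomputable def spex {W : Type*} (n : ℕ) (T : SimpleGraph W) : ℝ :=
  sSup {r : ℝ | ∃ G : SimpleGraph (Fin n), T.Free G ∧ lambda G = r}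

/-- `SPEX(n, T)`: the `n`-vertex `T`-free graphs whose spectral radius equals `spex(n, T)`. -/
def SPEX {W : Type*} (n : ℕ) (T : SimpleGraph W) : Set (SimpleGraph (Fin n)) :=
  {G | T.Free G ∧ lambda G = spex n T}

/-- The join `G ∨ H` of two graphs: their disjoint union together with all edges between them. -/
def join {V W : Type*} (G : SimpleGraph V) (H : SimpleGraph W) : SimpleGraph (V ⊕ W) :=
  (G ⊕g H) ⊔ completeBipartiteGraph V W

/-- The quotient matrix of the join of `K_l` with a `d`-regular graph on `n - l` vertices. -/
def quotientMatrix (l : ℕ) (d : ℝ) (n : ℕ) : Matrix (Fin 2) (Fin 2) ℝ :=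
  !![(l : ℝ) - 1, (n : ℝ) - l; (l : ℝ), d]

/-- `f(d, n)` for the parameter `l`; it is the largest root of the characteristic polynomial of
`quotientMatrix l d n`, see `isGreatest_f`. -/
noncomputable def f (l : ℕ) (d : ℝ) (n : ℕ) : ℝ :=
  ((l : ℝ) + d - 1 +
    Real.sqrt (((l : ℝ) + d - 1) ^ 2 + 4 * ((n : ℝ) * l + d - l * d - (l : ℝ) ^ 2))) / 2

theorem isGreatest_f (l : ℕ) (d : ℝ) (n : ℕ) (h : l ≤ n) :
    IsGreatest {r : ℝ | (quotientMatrix l d n).charpoly.IsRoot r} (f l d n) := by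
  have hD : 0 ≤ ((l : ℝ) + d - 1) ^ 2 + 4 * ((n : ℝ) * l + d - l * d - (l : ℝ) ^ 2) := by
    have h1 : (l : ℝ) ≤ n := by exact_mod_cast h
    have h2 : (0 : ℝ) ≤ l * ((n : ℝ) - l) := mul_nonneg (Nat.cast_nonneg l) (by linarith)
    nlinarith [sq_nonneg ((l : ℝ) - 1 - d)]
  have hs := Real.sq_sqrt hD
  have hn := Real.sqrt_nonneg
    (((l : ℝ) + d - 1) ^ 2 + 4 * ((n : ℝ) * l + d - l * d - (l : ℝ) ^ 2))
  have key : ∀ r : ℝ, (quotientMatrix l d n).charpoly.IsRoot r ↔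
      r ^ 2 - ((l : ℝ) - 1 + d) * r + (((l : ℝ) - 1) * d - ((n : ℝ) - l) * l) = 0 := by
    intro r
    simp [Polynomial.IsRoot, Matrix.charpoly_fin_two, quotientMatrix, Matrix.trace_fin_two,
      Matrix.det_fin_two]
  constructor
  · show (quotientMatrix l d n).charpoly.IsRoot _
    rw [key]
    unfold f
    nlinarith
  · intro r hr
    have hr' := (key r).1 hr
    unfold f
    have : 2 * r - ((l : ℝ) + d - 1) ≤ Real.sqrt
        (((l : ℝ) + d - 1) ^ 2 + 4 * ((n : ℝ) * l + d - l * d - (l : ℝ) ^ 2)) := by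
      apply Real.le_sqrt_of_sq_le
      nlinarith
    linarith

end SpectralTuran

namespace SpectralTuran

open Finset Matrix

/-! ### Spectral radius: Rayleigh bound, nonnegative eigenvector, Collatz–Wielandt bound -/

section Spectral

variable {V : Type*} [Fintype V] (G : SimpleGraph V)

/-! Write m for the order of T. An extremal graph should contain l dominating vertices: `K_{l,n-l}`
is T-free because both colour classes of T have more than l vertices, so the spectral radius r of an
extremal G satisfies r² ≥ l(n-l). Conversely, T-free graphs are sparse: fewer than m edges per
vertex, and between disjoint X and Y at most l|X| + m|Y| edges (`sum_card_inter_le_of_disjoint`).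
Let x be a nonnegative eigenvector with maximum 1. Counting weighted 2-walks gives r² x_v ≤ l·deg v
+ o(n), so large entries force large degree; the same count at a maximal entry shows that at least l
entries are close to 1. More than l such vertices would have many common neighbours, and T would
embed. So there are exactly l, forming a set L. If some vertex outside L missed a vertex of L, one
of these could be rewired to be adjacent exactly to L, keeping the graph T-free and raising the
spectral radius (`forall_adj_of_estimates`). Hence L dominates, and a vertex outside L with δ
neighbours outside L would complete a copy of T (`card_neighbors_lt`). For the converse comparison,
the joins in part 2 are T-free because a copy of T would contain a cycle (`free_join_top`). The
bounds by f come from one test vector, constant on each side of the join, and a nearly regular graph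
of degree δ-2. -/

theorem hasEigenvalue_iff (μ : ℝ) :
    Module.End.HasEigenvalue (Matrix.toLin' (G.adjMatrix ℝ)) μ ↔
      ∃ x : V → ℝ, x ≠ 0 ∧ ∀ v, ∑ u ∈ G.neighborFinset v, x u = μ * x v := by
  constructor
  · intro h
    obtain ⟨x, hx⟩ := h.exists_hasEigenvector
    refine ⟨x, hx.2, fun v => ?_⟩
    have := congrFun hx.apply_eq_smul v
    simpa [Matrix.toLin'_apply, SimpleGraph.adjMatrix_mulVec_apply] using this
  · rintro ⟨x, hx0, hx⟩
    refine Module.End.hasEigenvalue_of_hasEigenvector (x := x) ⟨?_, hx0⟩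
    rw [Module.End.mem_eigenspace_iff]
    ext v
    simpa [Matrix.toLin'_apply, SimpleGraph.adjMatrix_mulVec_apply] using hx v

omit [Fintype V] in
theorem isHermitian_adjMatrix : (G.adjMatrix ℝ).IsHermitian := by
  rw [Matrix.IsHermitian, Matrix.conjTranspose_eq_transpose_of_trivial]
  exact SimpleGraph.isSymm_adjMatrix G

/-- A symmetric real matrix on a nonempty index set has finitely many eigenvalues and at least one,
so the `sSup` in `lambda` is an attained maximum, not a default value. -/
theorem isGreatest_lambda [Nonempty V] :
    IsGreatest {μ : ℝ | Module.End.HasEigenvalue (Matrix.toLin' (G.adjMatrix ℝ)) μ} (lambda G) := by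
  have hfin : {μ : ℝ | Module.End.HasEigenvalue (Matrix.toLin' (G.adjMatrix ℝ)) μ}.Finite :=
    Module.End.finite_hasEigenvalue _
  have hne : {μ : ℝ | Module.End.HasEigenvalue (Matrix.toLin' (G.adjMatrix ℝ)) μ}.Nonempty := by
    let i : V := Classical.arbitrary V
    refine ⟨(isHermitian_adjMatrix G).eigenvalues i, ?_⟩
    have hs := (isHermitian_adjMatrix G).eigenvalues_mem_spectrum_real i
    rw [Set.mem_ofPred_eq, Module.End.hasEigenvalue_iff_mem_spectrum, Matrix.spectrum_toLin']
    exact hs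
  exact ⟨hne.csSup_mem hfin, fun μ hμ => le_csSup hfin.bddAbove hμ⟩

/-- An eigenvector of λI - A for θ is an eigenvector of A for λ - θ, and λ - θ ≤ λ by maximality. -/
theorem posSemidef_lambda_sub [Nonempty V] :
    (Matrix.diagonal (fun _ => lambda G) - G.adjMatrix ℝ).PosSemidef := by
  have hH : (Matrix.diagonal (fun _ => lambda G) - G.adjMatrix ℝ).IsHermitian :=
    (Matrix.isHermitian_diagonal _).sub (isHermitian_adjMatrix G)
  rw [hH.posSemidef_iff_eigenvalues_nonneg]
  intro i
  have h1 := hH.mulVec_eigenvectorBasis i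
  set x : V → ℝ := ⇑(hH.eigenvectorBasis i) with hx
  have hx0 : x ≠ 0 := fun h0 => (hH.eigenvectorBasis.toBasis.ne_zero i) (by
    ext v
    simpa using congrFun h0 v)
  have : lambda G - hH.eigenvalues i ≤ lambda G := by
    apply (isGreatest_lambda G).2
    rw [Set.mem_ofPred_eq, hasEigenvalue_iff]
    refine ⟨x, hx0, fun v => ?_⟩
    have h2 := congrFun h1 v
    simp only [Matrix.sub_mulVec, Matrix.mulVec_diagonal, Pi.sub_apply, Pi.smul_apply,
      smul_eq_mul, SimpleGraph.adjMatrix_mulVec_apply] at h2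
    linarith
  simpa using this

theorem dotProduct_lambda_sub (y : V → ℝ) :
    star y ⬝ᵥ ((Matrix.diagonal (fun _ => lambda G) - G.adjMatrix ℝ) *ᵥ y) =
      lambda G * ∑ v, y v ^ 2 - ∑ v, y v * ∑ u ∈ G.neighborFinset v, y u := by
  simp only [dotProduct, Matrix.sub_mulVec, Matrix.mulVec_diagonal, Pi.sub_apply, star_trivial,
    SimpleGraph.adjMatrix_mulVec_apply, mul_sub, Finset.sum_sub_distrib, Finset.mul_sum]
  congr 1
  exact Finset.sum_congr rfl fun v _ => by ring

/-- The Rayleigh bound. -/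
theorem rayleigh_le [Nonempty V] (y : V → ℝ) :
    ∑ v, y v * ∑ u ∈ G.neighborFinset v, y u ≤ lambda G * ∑ v, y v ^ 2 := by
  have h := (posSemidef_lambda_sub G).dotProduct_mulVec_nonneg y
  rw [dotProduct_lambda_sub] at h
  linarith

/-- Vectors attaining the Rayleigh bound are eigenvectors. -/
theorem eigenvector_of_rayleigh_ge [Nonempty V] (y : V → ℝ)
    (h : lambda G * ∑ v, y v ^ 2 ≤ ∑ v, y v * ∑ u ∈ G.neighborFinset v, y u) (v : V) :
    ∑ u ∈ G.neighborFinset v, y u = lambda G * y v := by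
  have h0 : star y ⬝ᵥ ((Matrix.diagonal (fun _ => lambda G) - G.adjMatrix ℝ) *ᵥ y) = 0 := by
    rw [dotProduct_lambda_sub]
    linarith [rayleigh_le G y]
  rw [(posSemidef_lambda_sub G).dotProduct_mulVec_zero_iff] at h0
  have := congrFun h0 v
  simp only [Matrix.sub_mulVec, Matrix.mulVec_diagonal, Pi.sub_apply, Pi.zero_apply,
    SimpleGraph.adjMatrix_mulVec_apply] at this
  linarith

/-- There is a nonnegative eigenvector for `lambda G` with maximum entry `1`. -/
theorem exists_perron_vector [Nonempty V] :
    ∃ x : V → ℝ, (∀ v, 0 ≤ x v) ∧ (∀ v, x v ≤ 1) ∧ (∃ z, x z = 1) ∧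
      ∀ v, ∑ u ∈ G.neighborFinset v, x u = lambda G * x v := by
  obtain ⟨y, hy0, hy⟩ := (hasEigenvalue_iff G _).1 (isGreatest_lambda G).1
  -- Taking absolute values cannot lower the quadratic form, so |y| attains the Rayleigh bound.
  -- Connectivity is not needed, but entries may vanish.
  have habs : ∀ v, ∑ u ∈ G.neighborFinset v, |y u| = lambda G * |y v| := by
    refine eigenvector_of_rayleigh_ge G (fun v => |y v|) ?_
    calc lambda G * ∑ v, |y v| ^ 2 = ∑ v, y v * ∑ u ∈ G.neighborFinset v, y u := by
          rw [Finset.mul_sum]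
          exact Finset.sum_congr rfl fun v _ => by rw [hy v, sq_abs]; ring
      _ ≤ ∑ v, |y v| * ∑ u ∈ G.neighborFinset v, |y u| := by
          refine Finset.sum_le_sum fun v _ => (le_abs_self _).trans ?_
          rw [abs_mul]
          exact mul_le_mul_of_nonneg_left (Finset.abs_sum_le_sum_abs _ _) (abs_nonneg _)
  obtain ⟨z, -, hz⟩ := Finset.exists_max_image univ (fun v => |y v|) univ_nonempty
  have hzpos : 0 < |y z| := by
    obtain ⟨w, hw⟩ := Function.ne_iff.1 hy0
    exact (abs_pos.2 hw).trans_le (hz w (mem_univ _))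
  refine ⟨fun v => |y v| / |y z|, fun v => by positivity, fun v => ?_, ⟨z, div_self hzpos.ne'⟩,
    fun v => ?_⟩
  · exact (div_le_one hzpos).2 (hz v (mem_univ _))
  · rw [← Finset.sum_div, habs v, mul_div_assoc]

/-- Collatz–Wielandt upper bound. -/
theorem lambda_le_of_pos [Nonempty V] (y : V → ℝ) (μ : ℝ) (hy : ∀ v, 0 < y v)
    (h : ∀ v, ∑ u ∈ G.neighborFinset v, y u ≤ μ * y v) : lambda G ≤ μ := by
  obtain ⟨x, hx0, -, ⟨z, hz⟩, hx⟩ := exists_perron_vector G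
  have hsymm : ∑ v, y v * ∑ u ∈ G.neighborFinset v, x u =
      ∑ v, x v * ∑ u ∈ G.neighborFinset v, y u := by
    simp only [Finset.mul_sum, SimpleGraph.neighborFinset_eq_filter, Finset.sum_filter]
    rw [Finset.sum_comm]
    exact Finset.sum_congr rfl fun v _ => Finset.sum_congr rfl fun u _ => by
      simp only [G.adj_comm u v]; split_ifs <;> ring
  have hpos : 0 < ∑ v, x v * y v :=
    Finset.sum_pos' (fun v _ => mul_nonneg (hx0 v) (hy v).le)
      ⟨z, mem_univ _, by rw [hz, one_mul]; exact hy z⟩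
  have : lambda G * ∑ v, x v * y v ≤ μ * ∑ v, x v * y v := by
    calc lambda G * ∑ v, x v * y v = ∑ v, y v * ∑ u ∈ G.neighborFinset v, x u := by
          rw [Finset.mul_sum]
          exact Finset.sum_congr rfl fun v _ => by rw [hx v]; ring
      _ = ∑ v, x v * ∑ u ∈ G.neighborFinset v, y u := hsymm
      _ ≤ ∑ v, x v * (μ * y v) :=
          Finset.sum_le_sum fun v _ => mul_le_mul_of_nonneg_left (h v) (hx0 v)
      _ = μ * ∑ v, x v * y v := by
          rw [Finset.mul_sum]
          exact Finset.sum_congr rfl fun v _ => by ring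
  exact le_of_mul_le_mul_right this hpos

end Spectral

theorem exists_eigenvector_congr {V V' : Type*} [Fintype V] [Fintype V'] {G : SimpleGraph V}
    {G' : SimpleGraph V'} (e : G ≃g G') {μ : ℝ}
    (h : ∃ x : V → ℝ, x ≠ 0 ∧ ∀ v, ∑ u ∈ G.neighborFinset v, x u = μ * x v) :
    ∃ x : V' → ℝ, x ≠ 0 ∧ ∀ v, ∑ u ∈ G'.neighborFinset v, x u = μ * x v := by
  obtain ⟨x, hx0, hx⟩ := h
  refine ⟨x ∘ e.symm, ?_, fun v => ?_⟩
  · obtain ⟨w, hw⟩ := Function.ne_iff.1 hx0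
    exact Function.ne_iff.2 ⟨e w, by simpa using hw⟩
  · rw [Function.comp_apply, ← hx (e.symm v)]
    simp only [SimpleGraph.neighborFinset_eq_filter, Finset.sum_filter]
    refine Fintype.sum_equiv e.symm.toEquiv _ _ fun u => ?_
    have : G.Adj (e.symm v) (e.symm u) ↔ G'.Adj v u := e.symm.map_adj_iff
    simp [this]

theorem lambda_congr {V V' : Type*} [Fintype V] [Fintype V'] {G : SimpleGraph V}
    {G' : SimpleGraph V'} (e : G ≃g G') : lambda G = lambda G' := by
  unfold lambda
  congr 1
  ext μ
  simp only [Set.mem_ofPred_eq, hasEigenvalue_iff]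
  exact ⟨exists_eigenvector_congr e, exists_eigenvector_congr e.symm⟩

/-! ### The extremal value is attained -/

section Spex

variable {W : Type*} (T : SimpleGraph W)

theorem finite_lambda_set (n : ℕ) :
    {r : ℝ | ∃ G : SimpleGraph (Fin n), T.Free G ∧ lambda G = r}.Finite :=
  (Set.finite_range fun G : SimpleGraph (Fin n) => lambda G).subset fun _ ⟨G, _, h⟩ => ⟨G, h⟩

variable {T}

theorem lambda_le_spex {n : ℕ} {G : SimpleGraph (Fin n)} (h : T.Free G) :
    lambda G ≤ spex n T :=
  le_csSup (finite_lambda_set T n).bddAbove ⟨G, h, rfl⟩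

theorem lambda_le_spex_of_card {V : Type*} [Fintype V] {n : ℕ} (hV : Fintype.card V = n)
    {G : SimpleGraph V} (h : T.Free G) : lambda G ≤ spex n T := by
  let e : V ≃ Fin n := Fintype.equivFinOfCardEq hV
  let i := SimpleGraph.Iso.map e G
  rw [lambda_congr i]
  exact lambda_le_spex ((SimpleGraph.free_congr_right i).1 h)

theorem exists_mem_SPEX (hT : T ≠ ⊥) (n : ℕ) : ∃ G, G ∈ SPEX n T := by
  obtain ⟨G, hG, h⟩ := Set.Nonempty.csSup_mem
    (s := {r : ℝ | ∃ G : SimpleGraph (Fin n), T.Free G ∧ lambda G = r})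
    ⟨_, ⊥, SimpleGraph.free_bot hT, rfl⟩ (finite_lambda_set T n)
  exact ⟨G, hG, h⟩

end Spex

/-! ### Greedy embedding of trees -/

section Greedy

/-- Greedy embedding of a tree: every tree vertex `w` is placed in its own target set `P w`. -/
theorem exists_embedding_of_card_le {V : Type*} [Fintype V] (G : SimpleGraph V) (k : ℕ) :
    ∀ {W : Type*} [Fintype W] {T : SimpleGraph W}, Fintype.card W = k → T.IsTree →
    ∀ P : W → Finset V, (∀ w, (P w).Nonempty) →
    (∀ w w', T.Adj w w' → ∀ p ∈ P w,
      #{w'' | ¬ Disjoint (P w'') (P w')} ≤ #(P w' ∩ G.neighborFinset p)) →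
    ∃ g : W → V, Function.Injective g ∧ (∀ w, g w ∈ P w) ∧
      ∀ w w', T.Adj w w' → G.Adj (g w) (g w') := by
  induction k with
  | zero =>
    intro W _ T hk hT
    have := hT.connected.nonempty
    exact absurd hk Fintype.card_ne_zero
  | succ k ih =>
    intro W _ T hk hT P hP h
    rcases subsingleton_or_nontrivial W with hW | hW
    · choose g hg using hP
      exact ⟨g, Function.injective_of_subsingleton g, hg,
        fun w w' hww => absurd (Subsingleton.elim w w') hww.ne⟩
    obtain ⟨r, hr⟩ := hT.exists_vert_degree_one_of_nontrivial
    obtain ⟨s, hrs, hs⟩ := SimpleGraph.degree_eq_one_iff_existsUnique_adj.1 hr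
    have hT' : (T.induce ({r}ᶜ : Set W)).IsTree :=
      ⟨hT.connected.induce_compl_singleton_of_degree_eq_one hr, hT.isAcyclic.induce _⟩
    have hk' : Fintype.card ({r}ᶜ : Set W) = k := by
      rw [Fintype.card_compl_set, hk]; simp
    obtain ⟨g, hginj, hgP, hg⟩ := ih hk' hT' (fun w => P w) (fun w => hP w)
      (fun w w' hww p hp => le_trans (by
        refine Finset.card_le_card_of_injOn (fun w => (w : W)) (fun w hw => ?_)
          Subtype.val_injective.injOn
        simpa using hw) (h w w' hww p hp))
    have hsr : s ∈ ({r}ᶜ : Set W) := by simpa using hrs.ne'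
    let p := g ⟨s, hsr⟩
    have hne : ∀ {w}, w ≠ r → w ∈ ({r}ᶜ : Set W) := fun hw => by simpa using hw
    -- Used vertices of `P r` are images of tree vertices other than the leaf r whose targets meet
    -- `P r`. The count in `h` includes r itself, so one candidate stays free.
    have hfresh : ∃ q ∈ P r ∩ G.neighborFinset p, ∀ w, g w ≠ q := by
      by_contra! hcon
      have h1 := h s r hrs.symm p (hgP _)
      have h2 : P r ∩ G.neighborFinset p ⊆
          (({w | ¬ Disjoint (P w) (P r)} : Finset W).erase r).image
            (fun w => if hw : w = r then p else g ⟨w, hne hw⟩) := by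
        intro q hq
        obtain ⟨w, hw⟩ := hcon q hq
        have hwr : (w : W) ≠ r := Set.mem_compl_singleton_iff.1 w.2
        refine mem_image.2 ⟨w, ?_, by simpa [hwr] using hw⟩
        simp only [mem_erase, mem_filter, mem_univ, true_and]
        exact ⟨hwr, Finset.not_disjoint_iff.2 ⟨q, hw ▸ hgP w, (mem_inter.1 hq).1⟩⟩
      have h3 := (card_le_card h2).trans card_image_le
      have hr' : r ∈ ({w | ¬ Disjoint (P w) (P r)} : Finset W) := by
        simpa using (hP r).ne_empty
      have := card_erase_lt_of_mem hr'
      omega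
    obtain ⟨q, hq, hqg⟩ := hfresh
    obtain ⟨hqP, hqp⟩ := mem_inter.1 hq
    rw [SimpleGraph.mem_neighborFinset] at hqp
    refine ⟨fun w => if hw : w = r then q else g ⟨w, hne hw⟩, ?_, ?_, ?_⟩
    · intro w w' hww
      by_cases hw : w = r <;> by_cases hw' : w' = r
      · rw [hw, hw']
      · simp only [hw, hw', dite_true, dite_false] at hww
        exact absurd hww.symm (hqg _)
      · simp only [hw, hw', dite_true, dite_false] at hww
        exact absurd hww (hqg _)
      · simp only [hw, hw', dite_false] at hww
        simpa using hginj hww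
    · intro w
      by_cases hw : w = r
      · simpa [hw] using hqP
      · simpa [hw] using hgP ⟨w, hne hw⟩
    · intro w w' hww
      by_cases hw : w = r <;> by_cases hw' : w' = r
      · exact absurd (hw.trans hw'.symm) hww.ne
      · subst hw
        obtain rfl := hs w' hww
        simpa [hw'] using hqp.symm
      · subst hw'
        obtain rfl := hs w hww.symm
        simpa [hw] using hqp
      · simpa [hw, hw'] using hg ⟨w, hne hw⟩ ⟨w', hne hw'⟩ hww

theorem isContained_of_card_le {V W : Type*} [Fintype V] [Fintype W] {T : SimpleGraph W}
    (hT : T.IsTree) (G : SimpleGraph V) (P : W → Finset V) (hP : ∀ w, (P w).Nonempty)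
    (h : ∀ w w', T.Adj w w' → ∀ p ∈ P w,
      #{w'' | ¬ Disjoint (P w'') (P w')} ≤ #(P w' ∩ G.neighborFinset p)) : T.IsContained G := by
  obtain ⟨g, hg, -, hadj⟩ := exists_embedding_of_card_le G _ rfl hT P hP h
  exact ⟨⟨⟨g, fun {a b} hab => hadj a b hab⟩, hg⟩⟩

end Greedy

/-! ### Sparsity of T-free graphs -/

section EdgeCounts

variable {V W : Type*} [Fintype V] [Fintype W] {T : SimpleGraph W} {G : SimpleGraph V}

/-- Otherwise the greedy embedding succeeds with S as the target of every tree vertex. -/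
theorem exists_card_inter_lt (hT : T.IsTree) (hG : T.Free G) {S : Finset V} (hS : S.Nonempty) :
    ∃ v ∈ S, #(G.neighborFinset v ∩ S) < Fintype.card W := by
  by_contra! hcon
  refine hG (isContained_of_card_le hT G (fun _ => S) (fun _ => hS) fun w w' _ p hp => ?_)
  rw [inter_comm]
  exact (card_le_univ _).trans (hcon p hp)

theorem sum_card_inter_erase (S : Finset V) {v : V} (hv : v ∈ S) :
    ∑ u ∈ S, #(G.neighborFinset u ∩ S) =
      ∑ u ∈ S.erase v, #(G.neighborFinset u ∩ S.erase v) + 2 * #(G.neighborFinset v ∩ S) := by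
  have h1 : ∀ u ∈ S.erase v, #(G.neighborFinset u ∩ S) =
      #(G.neighborFinset u ∩ S.erase v) + if G.Adj v u then 1 else 0 := by
    intro u _
    conv_lhs => rw [← insert_erase hv]
    split_ifs with h
    · rw [inter_insert_of_mem (by simpa using h.symm), card_insert_of_notMem (by simp)]
    · rw [inter_insert_of_notMem (by simpa [G.adj_comm u v] using h), add_zero]
  have h2 : ∑ u ∈ S.erase v, (if G.Adj v u then 1 else 0) = #(G.neighborFinset v ∩ S) := by
    rw [← card_filter]
    congr 1
    ext u
    simp only [mem_filter, mem_erase, mem_inter, SimpleGraph.mem_neighborFinset]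
    exact ⟨fun h => ⟨h.2, h.1.2⟩, fun h => ⟨⟨h.1.ne', h.2⟩, h.1⟩⟩
  rw [← add_sum_erase _ _ hv, sum_congr rfl h1, sum_add_distrib, h2]
  ring

/-- A graph without a copy of a tree `T` on `m` vertices has less than `m` edges per vertex. -/
theorem sum_card_inter_le (hT : T.IsTree) (hG : T.Free G) (S : Finset V) :
    ∑ u ∈ S, #(G.neighborFinset u ∩ S) ≤ 2 * Fintype.card W * #S := by
  induction hk : #S generalizing S with
  | zero => rw [card_eq_zero] at hk; simp [hk]
  | succ k ih =>
    obtain ⟨v, hv, hlt⟩ := exists_card_inter_lt hT hG (card_pos.1 (by omega : 0 < #S))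
    rw [sum_card_inter_erase S hv]
    have := ih (S.erase v) (by rw [card_erase_of_mem hv, hk]; rfl)
    nlinarith

theorem sum_degree_le (hT : T.IsTree) (hG : T.Free G) :
    ∑ u, G.degree u ≤ 2 * Fintype.card W * Fintype.card V := by
  simpa using sum_card_inter_le hT hG univ

variable {A : Finset W} {l : ℕ}

/-- A goes greedily into Y and the other class into X. Only A competes for places in Y, so l + 1
neighbours there suffice. -/
theorem isContained_of_bipartite (hT : T.IsTree) (hA : ∀ w w', T.Adj w w' → (w ∈ A ↔ w' ∉ A))
    (hAl : #A ≤ l + 1) {X Y : Finset V} (hXY : Disjoint X Y) (hX : X.Nonempty) (hY : Y.Nonempty)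
    (h1 : ∀ x ∈ X, l < #(G.neighborFinset x ∩ Y))
    (h2 : ∀ y ∈ Y, Fintype.card W ≤ #(G.neighborFinset y ∩ X)) : T.IsContained G := by
  refine isContained_of_card_le hT G (fun w => if w ∈ A then Y else X) (fun w => ?_)
    fun w w' hww p hp => ?_
  · split_ifs <;> assumption
  · have hA' := hA w w' hww
    rw [inter_comm]
    by_cases hw' : w' ∈ A
    · have hw : w ∉ A := fun h => hA'.1 h hw'
      simp only [hw, hw', if_true, if_false] at hp ⊢
      refine le_trans (card_le_card (t := A) fun w'' hw'' => ?_) (hAl.trans (h1 p hp))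
      simp only [mem_filter, mem_univ, true_and] at hw''
      by_contra hcon
      simp only [hcon, if_false] at hw''
      exact hw'' hXY
    · have hw : w ∈ A := hA'.2 hw'
      simp only [hw, hw', if_true, if_false] at hp ⊢
      exact (card_le_univ _).trans (h2 p hp)

theorem sum_card_inter_comm (X Y : Finset V) :
    ∑ x ∈ X, #(G.neighborFinset x ∩ Y) = ∑ y ∈ Y, #(G.neighborFinset y ∩ X) := by
  simp only [SimpleGraph.neighborFinset_eq_filter, filter_inter, univ_inter, card_filter]
  rw [sum_comm]
  exact sum_congr rfl fun y _ => sum_congr rfl fun x _ => by simp only [G.adj_comm]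

/-- Unbalanced bipartite subgraphs of a graph without a copy of `T` have few edges. -/
theorem sum_card_inter_le_of_disjoint (hT : T.IsTree)
    (hA : ∀ w w', T.Adj w w' → (w ∈ A ↔ w' ∉ A)) (hAl : #A ≤ l + 1) (hG : T.Free G)
    {X Y : Finset V} (hXY : Disjoint X Y) :
    ∑ x ∈ X, #(G.neighborFinset x ∩ Y) ≤ l * #X + Fintype.card W * #Y := by
  induction hk : #X + #Y generalizing X Y with
  | zero =>
    have : X = ∅ := card_eq_zero.1 (by omega)
    simp [this]
  | succ k ih =>
    by_cases hx : ∃ x ∈ X, #(G.neighborFinset x ∩ Y) ≤ l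
    · obtain ⟨x, hx, hle⟩ := hx
      have hc := card_erase_add_one hx
      have := ih (X := X.erase x) (Y := Y) (hXY.mono_left (erase_subset _ _)) (by omega)
      rw [← add_sum_erase _ _ hx, ← hc]
      nlinarith
    by_cases hy : ∃ y ∈ Y, #(G.neighborFinset y ∩ X) ≤ Fintype.card W
    · obtain ⟨y, hy, hle⟩ := hy
      have hc := card_erase_add_one hy
      have := ih (X := X) (Y := Y.erase y) (hXY.mono_right (erase_subset _ _)) (by omega)
      rw [sum_card_inter_comm] at this ⊢
      rw [← add_sum_erase _ _ hy, ← hc]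
      nlinarith
    -- No vertex can be peeled off at cost l (from X) or m (from Y), so the degrees suffice to embed
    -- T unless a side is empty.
    push Not at hx hy
    rcases X.eq_empty_or_nonempty with rfl | hX
    · simp
    rcases Y.eq_empty_or_nonempty with rfl | hY
    · simp
    exact absurd (isContained_of_bipartite hT hA hAl hXY hX hY hx fun y h => (hy y h).le) hG

end EdgeCounts

/-! ### Adjacency and neighbour sums in joins -/

section Join

variable {V₁ V₂ : Type*} {G : SimpleGraph V₁} {H : SimpleGraph V₂}

@[simp] theorem join_adj_inl_inl {a b : V₁} :
    (join G H).Adj (Sum.inl a) (Sum.inl b) ↔ G.Adj a b := by simp [join]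

@[simp] theorem join_adj_inr_inr {a b : V₂} :
    (join G H).Adj (Sum.inr a) (Sum.inr b) ↔ H.Adj a b := by simp [join]

@[simp] theorem join_adj_inl_inr {a : V₁} {b : V₂} :
    (join G H).Adj (Sum.inl a) (Sum.inr b) := by simp [join]

@[simp] theorem join_adj_inr_inl {a : V₁} {b : V₂} :
    (join G H).Adj (Sum.inr b) (Sum.inl a) := by simp [join]

variable [Fintype V₁] [Fintype V₂]

theorem sum_neighborFinset_join_inl (y : V₁ ⊕ V₂ → ℝ) (a : V₁) :
    ∑ u ∈ (join G H).neighborFinset (Sum.inl a), y u =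
      ∑ b ∈ G.neighborFinset a, y (Sum.inl b) + ∑ b, y (Sum.inr b) := by
  simp only [SimpleGraph.neighborFinset_eq_filter, sum_filter, Fintype.sum_sum_type]
  simp

theorem sum_neighborFinset_join_inr (y : V₁ ⊕ V₂ → ℝ) (a : V₂) :
    ∑ u ∈ (join G H).neighborFinset (Sum.inr a), y u =
      ∑ b, y (Sum.inl b) + ∑ b ∈ H.neighborFinset a, y (Sum.inr b) := by
  simp only [SimpleGraph.neighborFinset_eq_filter, sum_filter, Fintype.sum_sum_type]
  simp

end Join

/-! ### T-free joins with a complete graph -/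

section Free

variable {W : Type*} [Fintype W] {T : SimpleGraph W} {A : Finset W} {l : ℕ}

/-- The induced forest extends to a spanning tree of the complete graph on S, which has |S| - 1
edges. -/
theorem sum_card_inter_le_of_isAcyclic (hT : T.IsAcyclic) {S : Finset W} (hS : S.Nonempty) :
    ∑ w ∈ S, #(T.neighborFinset w ∩ S) + 2 ≤ 2 * #S := by
  have : Nonempty S := hS.to_subtype
  obtain ⟨F, hF, -, hFT⟩ := SimpleGraph.Connected.exists_isTree_le_of_le_of_isAcyclic
    (SimpleGraph.connected_top (V := S)) (H := T.induce (S : Set W)) le_top (hT.induce _)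
  have h1 := hFT.card_edgeFinset
  have h2 : #(T.induce (S : Set W)).edgeFinset ≤ #F.edgeFinset :=
    card_le_card (SimpleGraph.edgeFinset_mono hF)
  have h3 := (T.induce (S : Set W)).sum_degrees_eq_twice_card_edges
  have h4 : ∑ w : (S : Set W), (T.induce (S : Set W)).degree w =
      ∑ w ∈ S, #(T.neighborFinset w ∩ S) := by
    rw [← sum_coe_sort S]
    refine sum_congr rfl fun w _ => ?_
    rw [← SimpleGraph.card_neighborFinset_eq_degree,
      ← card_map (Function.Embedding.subtype (· ∈ (S : Set W)))]
    congr 1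
    ext u
    simp
  have h5 : Fintype.card (S : Set W) = #S := by simp
  rw [← h4, h3]
  omega

theorem mem_iff_of_two_colorings (hT : T.IsTree) (hA : ∀ w w', T.Adj w w' → (w ∈ A ↔ w' ∉ A))
    (B : Finset W) (hB : ∀ w w', T.Adj w w' → (w ∈ B ↔ w' ∉ B)) : B = A ∨ B = Aᶜ := by
  obtain ⟨r⟩ := hT.connected.nonempty
  have key : ∀ w, (w ∈ A ↔ w ∈ B) ↔ (r ∈ A ↔ r ∈ B) := by
    intro w
    obtain ⟨p⟩ := hT.connected.preconnected w r
    induction p with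
    | nil => rfl
    | cons h p ih => rw [← ih, hA _ _ h, hB _ _ h]; tauto
  by_cases hr : r ∈ A ↔ r ∈ B
  · left; ext w; exact ((key w).2 hr).symm
  · right; ext w; rw [mem_compl]; have := key w; tauto

theorem card_isLeft_le {V : Type*} {K : SimpleGraph (Fin l ⊕ V)} (g : T.Copy K) :
    #{w | (g w).isLeft} ≤ l := by
  have : ({w | (g w).isLeft} : Finset W).image g ⊆
      univ.image (Sum.inl : Fin l → Fin l ⊕ V) := by
    intro v hv
    obtain ⟨w, hw, rfl⟩ := mem_image.1 hv
    obtain ⟨a, ha⟩ := Sum.isLeft_iff.1 (mem_filter.1 hw).2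
    exact mem_image.2 ⟨a, mem_univ _, ha.symm⟩
  have h := (card_le_card this).trans card_image_le
  rwa [card_image_of_injective _ (show Function.Injective g from g.injective), card_univ,
    Fintype.card_fin] at h

/-- In a copy of T, the vertices on the left form a colour class, hence A or its complement; both
have more than l vertices. -/
theorem free_completeBipartiteGraph (hT : T.IsTree)
    (hA : ∀ w w', T.Adj w w' → (w ∈ A ↔ w' ∉ A)) (hAl : #A = l + 1) (hAc : #A ≤ #Aᶜ) (N : ℕ) :
    T.Free (completeBipartiteGraph (Fin l) (Fin N)) := by
  rintro ⟨g⟩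
  let B : Finset W := {w | (g w).isLeft}
  have hB : ∀ w w', T.Adj w w' → (w ∈ B ↔ w' ∉ B) := by
    intro w w' h
    have := g.toHom.map_adj h
    simp only [SimpleGraph.Copy.toHom_apply, completeBipartiteGraph_adj] at this
    simp only [B, mem_filter, mem_univ, true_and, Bool.not_eq_true, Sum.isLeft_eq_false]
    have h1 : ¬ ((g w).isLeft ∧ (g w).isRight) := by cases g w <;> simp
    have h2 : ¬ ((g w').isLeft ∧ (g w').isRight) := by cases g w' <;> simp
    tauto
  have hcard : #B ≤ l := card_isLeft_le g
  rcases mem_iff_of_two_colorings hT hA B hB with h | h <;> rw [h] at hcard <;> omega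

/-- Let S be the part of a copy of T inside K_l, X = A \ S and Y = S \ A, so |Y| < |X|. A vertex of
X has at least δ neighbours, at most δ - 2 of them outside S (with one exception, δ - 1); the others
lie in Y. This gives at least 2|X| - 1 ≥ |X| + |Y| edges between X and Y, too many for a forest. -/
theorem free_join_top {V : Type*} [Fintype V] {δ : ℕ} (hT : T.IsTree)
    (hA : ∀ w w', T.Adj w w' → (w ∈ A ↔ w' ∉ A)) (hAl : #A = l + 1)
    (hδ : ∀ w ∈ A, δ ≤ T.degree w) (hδ1 : 1 ≤ δ) (H : SimpleGraph V)
    (hH : ∀ v, H.degree v ≤ δ - 1) (hH1 : #{v | H.degree v = δ - 1} ≤ 1) :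
    T.Free (join (⊤ : SimpleGraph (Fin l)) H) := by
  rintro ⟨g⟩
  let S : Finset W := {w | (g w).isLeft}
  have hScard : #S ≤ l := card_isLeft_le g
  have hr : ∀ w, w ∉ S → ∃ v, g w = Sum.inr v := fun w hw => by
    simpa [S, Sum.isRight_iff] using hw
  have hne : Nonempty V := by
    obtain ⟨w, -, hw⟩ := exists_mem_notMem_of_card_lt_card (by omega : #S < #A)
    exact ⟨(hr w hw).choose⟩
  choose! r hr using hr
  have hdeg : ∀ w ∉ S, #(T.neighborFinset w \ S) ≤ H.degree (r w) := by
    intro w hw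
    rw [← SimpleGraph.card_neighborFinset_eq_degree]
    refine card_le_card_of_injOn r (fun u hu => ?_) fun u hu u' hu' h => ?_
    · simp only [coe_sdiff, Set.mem_sdiff, mem_coe, SimpleGraph.mem_neighborFinset] at hu ⊢
      have := g.toHom.map_adj hu.1
      rwa [SimpleGraph.Copy.toHom_apply, SimpleGraph.Copy.toHom_apply, hr w hw, hr u hu.2,
        join_adj_inr_inr] at this
    · simp only [coe_sdiff, Set.mem_sdiff, mem_coe] at hu hu'
      exact g.injective (by
        rw [SimpleGraph.Copy.toHom_apply, SimpleGraph.Copy.toHom_apply, hr u hu.2, hr u' hu'.2, h])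
  let X := A \ S
  let Y := S \ A
  have hXY : #Y < #X := by
    have h1 := card_sdiff_add_card_inter A S
    have h2 := card_sdiff_add_card_inter S A
    rw [inter_comm S A] at h2
    simp only [X, Y]
    omega
  have hdisj : Disjoint X Y := by
    rw [disjoint_left]; intro w hw hw'
    exact (mem_sdiff.1 hw').2 (mem_sdiff.1 hw).1
  have hX : ∀ w ∈ X, δ ≤ #(T.neighborFinset w ∩ Y) + #(T.neighborFinset w \ S) := by
    intro w hw
    obtain ⟨hwA, -⟩ := mem_sdiff.1 hw
    refine (hδ w hwA).trans ?_
    rw [← SimpleGraph.card_neighborFinset_eq_degree, ← card_inter_add_card_sdiff _ S]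
    refine Nat.add_le_add_right (card_le_card fun u hu => ?_) _
    simp only [mem_inter, SimpleGraph.mem_neighborFinset] at hu
    simp only [mem_inter, SimpleGraph.mem_neighborFinset, Y, mem_sdiff]
    exact ⟨hu.1, hu.2, (hA w u hu.1).1 hwA⟩
  have hrinj : Set.InjOn r X := fun w hw w' hw' h => g.injective (by
    rw [SimpleGraph.Copy.toHom_apply, SimpleGraph.Copy.toHom_apply,
      hr w (mem_sdiff.1 (mem_coe.1 hw)).2, hr w' (mem_sdiff.1 (mem_coe.1 hw')).2, h])
  have hX2 : 2 * #X ≤ ∑ w ∈ X, #(T.neighborFinset w ∩ Y) + 1 := by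
    have h1 : ∑ w ∈ X, 2 ≤ ∑ w ∈ X, (#(T.neighborFinset w ∩ Y) +
        if H.degree (r w) = δ - 1 then 1 else 0) := by
      refine sum_le_sum fun w hw => ?_
      have ha := hX w hw
      have hb := hdeg w (mem_sdiff.1 hw).2
      have hc := hH (r w)
      split_ifs <;> omega
    have h2 : ∑ w ∈ X, (if H.degree (r w) = δ - 1 then 1 else 0) ≤ 1 := by
      rw [← card_filter]
      refine le_trans (card_le_card_of_injOn r (fun w hw => ?_)
        (hrinj.mono (filter_subset _ _))) hH1
      simpa using (mem_filter.1 hw).2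
    rw [sum_add_distrib, sum_const, smul_eq_mul] at h1
    omega
  have hXne : (X ∪ Y).Nonempty := (card_pos.1 (by omega : 0 < #X)).mono subset_union_left
  have hac := sum_card_inter_le_of_isAcyclic hT.isAcyclic hXne
  rw [sum_union hdisj, card_union_of_disjoint hdisj] at hac
  have hl1 : ∑ w ∈ X, #(T.neighborFinset w ∩ Y) ≤ ∑ w ∈ X, #(T.neighborFinset w ∩ (X ∪ Y)) :=
    sum_le_sum fun w _ => card_le_card (inter_subset_inter_left subset_union_right)
  have hl2 : ∑ w ∈ Y, #(T.neighborFinset w ∩ X) ≤ ∑ w ∈ Y, #(T.neighborFinset w ∩ (X ∪ Y)) :=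
    sum_le_sum fun w _ => card_le_card (inter_subset_inter_left subset_union_left)
  rw [sum_card_inter_comm] at hl2
  omega

end Free

/-! ### Consequences of a set of l vertices joined to many others -/

section Structure

variable {V W : Type*} [Fintype V] [Fintype W] {T : SimpleGraph W} {G : SimpleGraph V}
  {A : Finset W} {l : ℕ}

/-- If `C` is completely joined to a set `L` of `l` vertices, then every vertex outside `L` has
few neighbours in `C`. -/
theorem card_neighbors_lt (hT : T.IsTree) (hA : ∀ w w', T.Adj w w' → (w ∈ A ↔ w' ∉ A))
    (hAl : #A = l + 1) {a : W} (ha : a ∈ A) (hG : T.Free G) {L C : Finset V} (hL : #L = l)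
    (hLC : ∀ u ∈ L, ∀ c ∈ C, G.Adj u c) (hC : 2 * Fintype.card W ≤ #C) {v : V} (hv : v ∉ L) :
    #(G.neighborFinset v ∩ C) < T.degree a := by
  by_contra! hcon
  obtain ⟨D, hD, hDcard⟩ := exists_subset_card_eq hcon
  have hDC : D ⊆ C := hD.trans inter_subset_right
  have hDv : ∀ d ∈ D, G.Adj v d := fun d hd => by
    simpa using (mem_inter.1 (hD hd)).1
  have hCL : ∀ c ∈ C, c ∉ L := fun c hc hcL => (hLC c hcL c hc).ne rfl
  -- The vertex v may lie in C. Since |D| < m, removing D and v from at least 2m vertices leaves at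
  -- least m.
  let C' := C \ insert v D
  have hC'C : C' ⊆ C := sdiff_subset
  have hlt : T.degree a < Fintype.card W := T.degree_lt_card_verts a
  have hC' : Fintype.card W ≤ #C' := by
    have h1 := le_card_sdiff (insert v D) C
    have h2 := card_insert_le v D
    simp only [C']
    omega
  have hC'v : v ∉ C' := by simp [C']
  have hC'D : ∀ c ∈ C', c ∉ D := fun c hc hcD => by simp [C', hcD] at hc
  have hvD : v ∉ D := fun h => (hDv v h).ne rfl
  have hnotA : ∀ w, T.Adj a w → w ∉ A := fun w h => (hA a w h).1 ha
  have hnea : ∀ w, w ∉ A → w ≠ a := fun w h h' => h (h' ▸ ha)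
  -- The targets {v}, L, D, C' are pairwise disjoint. The first three have exactly as many places as
  -- tree vertices assigned to them, and C' has room for all of T.
  let P : W → Finset V := fun w =>
    if w = a then {v} else if w ∈ A then L else if T.Adj a w then D else C'
  have P_a : P a = {v} := by simp [P]
  have P_A : ∀ w ∈ A, w ≠ a → P w = L := fun w h h' => by simp [P, h, h']
  have P_D : ∀ w, T.Adj a w → P w = D := fun w h => by
    simp [P, h, hnotA w h, hnea w (hnotA w h)]
  have P_C : ∀ w, w ∉ A → ¬ T.Adj a w → P w = C' := fun w h h' => by
    simp [P, h, h', hnea w h]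
  have P_cases : ∀ w, (w = a ∧ P w = {v}) ∨ (w ∈ A ∧ w ≠ a ∧ P w = L) ∨
      (T.Adj a w ∧ P w = D) ∨ (w ∉ A ∧ ¬ T.Adj a w ∧ P w = C') := by
    intro w
    by_cases h1 : w = a
    · exact Or.inl ⟨h1, h1 ▸ P_a⟩
    by_cases h2 : w ∈ A
    · exact Or.inr (Or.inl ⟨h2, h1, P_A w h2 h1⟩)
    by_cases h3 : T.Adj a w
    · exact Or.inr (Or.inr (Or.inl ⟨h3, P_D w h3⟩))
    · exact Or.inr (Or.inr (Or.inr ⟨h2, h3, P_C w h2 h3⟩))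
  have P_sub : ∀ w, w ∉ A → P w ⊆ C := by
    intro w hw
    by_cases h : T.Adj a w
    · rw [P_D w h]; exact hDC
    · rw [P_C w hw h]; exact hC'C
  refine hG (isContained_of_card_le hT G P (fun w => ?_) fun w w' hww p hp => ?_)
  · rcases P_cases w with ⟨-, h⟩ | ⟨hw, hwa, h⟩ | ⟨hw, h⟩ | ⟨-, -, h⟩ <;> rw [h]
    · exact singleton_nonempty v
    · have := one_lt_card.2 ⟨w, hw, a, ha, hwa⟩
      exact card_pos.1 (by omega)
    · rw [← card_pos, hDcard, SimpleGraph.degree_pos_iff_exists_adj]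
      exact ⟨w, hw⟩
    · have : 0 < Fintype.card W := Fintype.card_pos_iff.2 ⟨w⟩
      exact card_pos.1 (by omega)
  · have bound : ∀ (B : Finset W) (Q : Finset V), P w' = Q → Q ⊆ G.neighborFinset p →
        #B ≤ #Q → (∀ w'', w'' ∉ B → Disjoint (P w'') Q) →
        #{w'' | ¬ Disjoint (P w'') (P w')} ≤ #(P w' ∩ G.neighborFinset p) := by
      intro B Q hQ hQp hBQ hB
      rw [hQ, inter_eq_left.2 hQp]
      refine le_trans (card_le_card fun w'' hw'' => ?_) hBQ
      by_contra h
      exact (mem_filter.1 hw'').2 (hB w'' h)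
    rcases P_cases w' with ⟨hw', h⟩ | ⟨hw', hwa', h⟩ | ⟨hw', h⟩ | ⟨hw', haw', h⟩
    · subst hw'
      have hpD : p ∈ D := P_D w hww.symm ▸ hp
      refine bound {w'} {v} h (by simpa using (hDv p hpD).symm) (by simp) fun w'' hw'' => ?_
      rw [disjoint_singleton_right]
      rcases P_cases w'' with ⟨h'', -⟩ | ⟨-, -, h''⟩ | ⟨-, h''⟩ | ⟨-, -, h''⟩
      · simp [h''] at hw''
      all_goals rw [h'']; assumption
    · have hpC : p ∈ C := P_sub w (fun h' => (hA w w' hww).1 h' hw') hp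
      refine bound (A.erase a) L h (fun u hu => ?_) (by rw [card_erase_of_mem ha]; omega)
        fun w'' hw'' => ?_
      · simpa using (hLC u hu p hpC).symm
      · by_cases h2 : w'' = a
        · rw [h2, P_a]; simpa using hv
        · have h3 : w'' ∉ A := fun h3 => hw'' (mem_erase.2 ⟨h2, h3⟩)
          rw [disjoint_left]
          exact fun c hc => hCL c (P_sub w'' h3 hc)
    · refine bound (T.neighborFinset a) D h (fun d hd => ?_) (by rw [hDcard]; simp)
        fun w'' hw'' => ?_
      · rw [SimpleGraph.mem_neighborFinset]
        have hwA : w ∈ A := (hA w w' hww).2 (hnotA w' hw')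
        by_cases hwa : w = a
        · rw [hwa, P_a, mem_singleton] at hp
          exact hp ▸ hDv d hd
        · rw [P_A w hwA hwa] at hp
          exact hLC p hp d (hDC hd)
      · rw [disjoint_left]
        intro c hc hcD
        rcases P_cases w'' with ⟨-, h''⟩ | ⟨-, -, h''⟩ | ⟨h2, -⟩ | ⟨-, -, h''⟩
        · rw [h'', mem_singleton] at hc
          exact hvD (hc ▸ hcD)
        · exact hCL c (hDC hcD) (h'' ▸ hc)
        · exact hw'' (by simpa using h2)
        · exact hC'D c (h'' ▸ hc) hcD
    · refine bound univ C' h (fun c hc => ?_) (by simpa using hC')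
        fun w'' hw'' => absurd (mem_univ _) hw''
      rw [SimpleGraph.mem_neighborFinset]
      have hwA : w ∈ A := (hA w w' hww).2 hw'
      have hwa : w ≠ a := fun h => haw' (h ▸ hww)
      rw [P_A w hwA hwa] at hp
      exact hLC p hp c (hC'C hc)

/-- Replace the neighbourhood of `v` by `L`. -/
def rewire (G : SimpleGraph V) (L : Finset V) (v : V) (hv : v ∉ L) : SimpleGraph V where
  Adj a b := if a = v then b ∈ L else if b = v then a ∈ L else G.Adj a b
  symm := ⟨fun a b h => by
    by_cases ha : a = v <;> by_cases hb : b = v <;> simp_all [G.adj_comm]⟩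
  loopless := ⟨fun a h => by
    by_cases ha : a = v <;> simp_all⟩

omit [Fintype V] in
theorem rewire_adj {L : Finset V} {v : V} (hv : v ∉ L) {a b : V} :
    (rewire G L v hv).Adj a b ↔ if a = v then b ∈ L else if b = v then a ∈ L else G.Adj a b :=
  Iff.rfl

omit [Fintype V] in
-- A copy of T through v leaves some c in C unused. As c is adjacent to all of L, it can replace v,
-- giving a copy in G.
theorem free_rewire (hG : T.Free G) {L C : Finset V} {v : V} (hv : v ∉ L)
    (hLC : ∀ u ∈ L, ∀ c ∈ C, G.Adj u c) (hC : Fintype.card W ≤ #C) (hvC : v ∉ C) :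
    T.Free (rewire G L v hv) := by
  rintro ⟨g⟩
  have hg : ∀ w w', T.Adj w w' → if g w = v then g w' ∈ L else if g w' = v then g w ∈ L
      else G.Adj (g w) (g w') := fun w w' h => g.toHom.map_adj h
  have hinj : Function.Injective g := g.injective
  by_cases hex : ∃ w, g w = v
  · obtain ⟨r, hr⟩ := hex
    have hc : ∃ c ∈ C, ∀ w, g w ≠ c := by
      by_contra! hcon
      have h1 : insert v C ⊆ univ.image g := by
        refine insert_subset (mem_image.2 ⟨r, mem_univ _, hr⟩) fun c hc => ?_
        obtain ⟨w, hw⟩ := hcon c hc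
        exact mem_image.2 ⟨w, mem_univ _, hw⟩
      have h2 := (card_le_card h1).trans card_image_le
      rw [card_insert_of_notMem hvC, card_univ] at h2
      omega
    obtain ⟨c, hcC, hcg⟩ := hc
    have hne : ∀ w, w ≠ r → g w ≠ v := fun w hw h => hw (hinj (h.trans hr.symm))
    refine hG ⟨⟨⟨fun w => if w = r then c else g w, fun {a b} hab => ?_⟩, fun a b hab => ?_⟩⟩
    · have h := hg a b hab
      by_cases ha : a = r <;> by_cases hb : b = r
      · exact absurd (ha.trans hb.symm) hab.ne
      · rw [ha, if_pos hr] at h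
        simpa [ha, hb] using (hLC _ h c hcC).symm
      · rw [if_neg (hne a ha), hb, if_pos hr] at h
        simpa [ha, hb] using hLC _ h c hcC
      · rw [if_neg (hne a ha), if_neg (hne b hb)] at h
        simpa [ha, hb] using h
    · change (if a = r then c else g a) = (if b = r then c else g b) at hab
      by_cases ha : a = r <;> by_cases hb : b = r
      · rw [ha, hb]
      · rw [if_pos ha, if_neg hb] at hab
        exact absurd hab.symm (hcg b)
      · rw [if_neg ha, if_pos hb] at hab
        exact absurd hab (hcg a)
      · rw [if_neg ha, if_neg hb] at hab
        exact hinj hab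
  · push Not at hex
    refine hG ⟨⟨⟨g, fun {a b} hab => ?_⟩, hinj⟩⟩
    have h := hg a b hab
    rwa [if_neg (hex a), if_neg (hex b)] at h

theorem exists_iso_join {n : ℕ} {G : SimpleGraph (Fin n)} {L : Finset (Fin n)} (hL : #L = l)
    (h : ∀ u ∈ L, ∀ v ∉ L, G.Adj u v) {d : ℕ} (hd : ∀ v ∉ L, #(G.neighborFinset v ∩ Lᶜ) ≤ d) :
    ∃ (H₁ : SimpleGraph (Fin l)) (H₂ : SimpleGraph (Fin (n - l))),
      Nonempty (G ≃g join H₁ H₂) ∧ H₂.maxDegree ≤ d := by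
  let e₁ : {v // v ∈ L} ≃ Fin l := Fintype.equivFinOfCardEq (by simpa using hL)
  let e₂ : {v // v ∉ L} ≃ Fin (n - l) := Fintype.equivFinOfCardEq (by
    rw [Fintype.card_subtype_compl]; simp [hL])
  let e : Fin l ⊕ Fin (n - l) ≃ Fin n :=
    (Equiv.sumCongr e₁.symm e₂.symm).trans (Equiv.sumCompl (· ∈ L))
  have he₁ : ∀ i, e (Sum.inl i) = (e₁.symm i : Fin n) := fun i => rfl
  have he₂ : ∀ i, e (Sum.inr i) = (e₂.symm i : Fin n) := fun i => rfl
  refine ⟨G.comap (e ∘ Sum.inl), G.comap (e ∘ Sum.inr), ⟨SimpleGraph.Iso.symm ⟨e, ?_⟩⟩, ?_⟩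
  · rintro (i | i) (j | j)
    · simp
    · simpa [he₁, he₂] using h _ (e₁.symm i).2 _ (e₂.symm j).2
    · simpa [he₁, he₂] using (h _ (e₁.symm j).2 _ (e₂.symm i).2).symm
    · simp
  · refine SimpleGraph.maxDegree_le_of_forall_degree_le _ _ fun i => ?_
    refine le_trans ?_ (hd (e (Sum.inr i)) (e₂.symm i).2)
    rw [← SimpleGraph.card_neighborFinset_eq_degree]
    refine card_le_card_of_injOn (fun j => e (Sum.inr j)) (fun j hj => ?_)
      (e.injective.comp Sum.inr_injective).injOn
    simp only [coe_inter, Set.mem_inter_iff, mem_coe, SimpleGraph.mem_neighborFinset,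
      mem_compl] at hj ⊢
    exact ⟨hj, (e₂.symm j).2⟩

end Structure

/-! ### Rewiring increases the spectral radius -/

section Rewire

variable {V : Type*} [Fintype V] [Nonempty V] {G : SimpleGraph V} {x : V → ℝ}

/-- The quadratic form at x grows by 2 x_v (∑_L x - λ x_v), which may be zero since x_v may vanish.
If the spectral radius did not grow, x would attain the new Rayleigh bound and be an eigenvector of
the new graph, and its equation at v contradicts `hlt`. -/
theorem lambda_lt_lambda_rewire (hx0 : ∀ v, 0 ≤ x v)
    (hx : ∀ v, ∑ u ∈ G.neighborFinset v, x u = lambda G * x v) {L : Finset V} {v : V}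
    (hv : v ∉ L) (hlt : lambda G * x v < ∑ u ∈ L, x u) :
    lambda G < lambda (rewire G L v hv) := by
  set G' := rewire G L v hv with hG'
  have hv' : ∑ u ∈ G'.neighborFinset v, x u = ∑ u ∈ L, x u := by
    refine sum_congr ?_ fun _ _ => rfl
    ext u
    simp [hG', rewire_adj]
  have hrow : ∀ a, a ≠ v → ∑ u ∈ G'.neighborFinset a, x u = lambda G * x a +
      x v * ((if a ∈ L then 1 else 0) - if G.Adj v a then 1 else 0) := by
    intro a ha
    rw [← hx a]
    simp only [SimpleGraph.neighborFinset_eq_filter, sum_filter]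
    rw [← add_sum_erase _ _ (mem_univ v), ← add_sum_erase (s := univ) (a := v) _ (mem_univ v)]
    have : ∑ b ∈ univ.erase v, (if G'.Adj a b then x b else 0) =
        ∑ b ∈ univ.erase v, (if G.Adj a b then x b else 0) :=
      sum_congr rfl fun b hb => by
        have hb := ne_of_mem_erase hb
        simp [hG', rewire_adj, ha, hb]
    rw [this]
    have h1 : G'.Adj a v ↔ a ∈ L := by simp [hG', rewire_adj, ha]
    simp only [h1, G.adj_comm v a]
    split_ifs <;> ring
  have hform : ∑ a, x a * ∑ u ∈ G'.neighborFinset a, x u =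
      lambda G * ∑ a, x a ^ 2 + 2 * x v * (∑ u ∈ L, x u - lambda G * x v) := by
    have hF : ∀ a, x a * ∑ u ∈ G'.neighborFinset a, x u = lambda G * x a ^ 2 +
        x v * ((if a ∈ L then x a else 0) - if G.Adj v a then x a else 0) +
        if a = v then x v * (∑ u ∈ L, x u - lambda G * x v) else 0 := by
      intro a
      by_cases ha : a = v
      · subst ha
        rw [hv']
        simp only [hv, if_false, SimpleGraph.irrefl, if_true]
        ring
      · rw [hrow a ha, if_neg ha]
        split_ifs <;> ring
    have hN : ∑ a, (if G.Adj v a then x a else 0) = lambda G * x v := by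
      rw [← hx v, SimpleGraph.neighborFinset_eq_filter, sum_filter]
    have hL : ∑ a, (if a ∈ L then x a else 0) = ∑ u ∈ L, x u := by
      rw [← sum_filter]; simp
    rw [sum_congr rfl fun a _ => hF a, sum_add_distrib, sum_add_distrib, ← mul_sum, ← mul_sum,
      sum_sub_distrib, hN, hL, sum_ite_eq' univ v, if_pos (mem_univ v)]
    ring
  by_contra! hle
  have hsq : 0 ≤ ∑ a, x a ^ 2 := sum_nonneg fun a _ => sq_nonneg _
  have hge : lambda G' * ∑ a, x a ^ 2 ≤ ∑ a, x a * ∑ u ∈ G'.neighborFinset a, x u := by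
    rw [hform]
    have h1 : 0 ≤ x v * (∑ u ∈ L, x u - lambda G * x v) :=
      mul_nonneg (hx0 v) (sub_pos.2 hlt).le
    nlinarith [mul_le_mul_of_nonneg_right hle hsq]
  have h := eigenvector_of_rayleigh_ge G' x hge v
  rw [hv'] at h
  nlinarith [mul_le_mul_of_nonneg_right hle (hx0 v)]

end Rewire

/-! ### Eigenvector entries of T-free graphs -/

section Estimates

variable {V W : Type*} [Fintype V] [Fintype W] {T : SimpleGraph W} {G : SimpleGraph V}
  {A : Finset W} {l : ℕ} {x : V → ℝ} {r α η : ℝ}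

/-- An entry of at least α forces degree at least rα, while the degrees sum to at most 2m times the
order. -/
theorem card_large_entries_le (hT : T.IsTree) (hG : T.Free G)
    (hx1 : ∀ v, x v ≤ 1) (hx : ∀ v, ∑ u ∈ G.neighborFinset v, x u = r * x v) (hr : 0 < r)
    (hα : 0 < α) (hαr : 2 * Fintype.card W ≤ α ^ 2 * r) :
    (#{v | α ≤ x v} : ℝ) ≤ α * Fintype.card V := by
  have h1 : ∀ v ∈ ({v | α ≤ x v} : Finset V), r * α ≤ G.degree v := by
    intro v hv
    calc r * α ≤ r * x v := mul_le_mul_of_nonneg_left (mem_filter.1 hv).2 hr.le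
      _ = ∑ u ∈ G.neighborFinset v, x u := (hx v).symm
      _ ≤ ∑ u ∈ G.neighborFinset v, 1 := sum_le_sum fun u _ => hx1 u
      _ = G.degree v := by simp
  have h2 : #{v | α ≤ x v} * (r * α) ≤ ∑ v ∈ ({v | α ≤ x v} : Finset V), (G.degree v : ℝ) := by
    simpa using card_nsmul_le_sum _ _ _ h1
  have h3 : ∑ v ∈ ({v | α ≤ x v} : Finset V), (G.degree v : ℝ) ≤ ∑ v, (G.degree v : ℝ) :=
    sum_le_sum_of_subset_of_nonneg (filter_subset _ _) fun _ _ _ => by positivity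
  have h4 : (∑ v, (G.degree v : ℝ)) ≤ 2 * Fintype.card W * Fintype.card V := by
    exact_mod_cast sum_degree_le hT hG
  have hN : (0 : ℝ) ≤ Fintype.card V := by positivity
  have h5 : #{v | α ≤ x v} * (r * α) ≤ (α * Fintype.card V) * (r * α) := by
    nlinarith [mul_le_mul_of_nonneg_right hαr hN]
  exact le_of_mul_le_mul_right h5 (by positivity)

/-- Counting weighted walks of length two from `v` through small entries and into large ones. -/
theorem sq_mul_le (hT : T.IsTree) (hG : T.Free G) (hx0 : ∀ v, 0 ≤ x v)
    (hx1 : ∀ v, x v ≤ 1) (hx : ∀ v, ∑ u ∈ G.neighborFinset v, x u = r * x v)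
    (hα : 0 < α) {L : Finset V} (hL : ∀ v ∉ L, x v ≤ α)
    (hLcard : (#L : ℝ) ≤ α * Fintype.card V) (v : V) :
    r ^ 2 * x v ≤ ∑ u ∈ G.neighborFinset v \ L, ∑ w ∈ G.neighborFinset u ∩ L, x w +
      4 * α * Fintype.card W * Fintype.card V := by
  have h0 : r ^ 2 * x v = ∑ u ∈ G.neighborFinset v, ∑ w ∈ G.neighborFinset u, x w := by
    rw [sum_congr rfl fun u _ => hx u, ← mul_sum, hx v]; ring
  have h1 : ∀ u, ∑ w ∈ G.neighborFinset u, x w ≤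
      ∑ w ∈ G.neighborFinset u ∩ L, x w + α * G.degree u := by
    intro u
    rw [← sum_inter_add_sum_sdiff (G.neighborFinset u) L]
    have : ∑ w ∈ G.neighborFinset u \ L, x w ≤ ∑ w ∈ G.neighborFinset u \ L, α :=
      sum_le_sum fun w hw => hL w (mem_sdiff.1 hw).2
    rw [sum_const, nsmul_eq_mul] at this
    have h2 : (#(G.neighborFinset u \ L) : ℝ) ≤ G.degree u := by
      exact_mod_cast card_le_card sdiff_subset
    nlinarith
  have h2 : ∑ u ∈ G.neighborFinset v, α * (G.degree u : ℝ) ≤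
      2 * α * Fintype.card W * Fintype.card V := by
    have h4 : (∑ v, (G.degree v : ℝ)) ≤ 2 * Fintype.card W * Fintype.card V := by
      exact_mod_cast sum_degree_le hT hG
    have h5 : ∑ u ∈ G.neighborFinset v, (G.degree u : ℝ) ≤ ∑ u, (G.degree u : ℝ) :=
      sum_le_sum_of_subset_of_nonneg (subset_univ _) fun _ _ _ => by positivity
    rw [← mul_sum]
    nlinarith
  -- Walks staying in L are bounded by the degree sum inside L, small because L is small.
  have h3 : ∑ u ∈ G.neighborFinset v ∩ L, ∑ w ∈ G.neighborFinset u ∩ L, x w ≤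
      2 * α * Fintype.card W * Fintype.card V := by
    calc ∑ u ∈ G.neighborFinset v ∩ L, ∑ w ∈ G.neighborFinset u ∩ L, x w
        ≤ ∑ u ∈ L, ∑ w ∈ G.neighborFinset u ∩ L, x w :=
          sum_le_sum_of_subset_of_nonneg inter_subset_right fun _ _ _ =>
            sum_nonneg fun w _ => hx0 w
      _ ≤ ∑ u ∈ L, (#(G.neighborFinset u ∩ L) : ℝ) := sum_le_sum fun u _ => by
          simpa using sum_le_card_nsmul (G.neighborFinset u ∩ L) x 1 fun w _ => hx1 w
      _ ≤ 2 * Fintype.card W * #L := by exact_mod_cast sum_card_inter_le hT hG L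
      _ ≤ 2 * α * Fintype.card W * Fintype.card V := by
          have : (0 : ℝ) ≤ Fintype.card W := by positivity
          nlinarith
  rw [h0]
  refine (sum_le_sum fun u _ => h1 u).trans ?_
  rw [sum_add_distrib, ← sum_inter_add_sum_sdiff (G.neighborFinset v) L]
  linarith

theorem sum_card_sdiff_le (hT : T.IsTree) (hA : ∀ w w', T.Adj w w' → (w ∈ A ↔ w' ∉ A))
    (hAl : #A = l + 1) (hG : T.Free G) {L : Finset V}
    (hLcard : (#L : ℝ) ≤ α * Fintype.card V) (v : V) :
    ∑ u ∈ G.neighborFinset v \ L, (#(G.neighborFinset u ∩ L) : ℝ) ≤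
      l * G.degree v + α * Fintype.card W * Fintype.card V := by
  have h1 : ∑ u ∈ G.neighborFinset v \ L, (#(G.neighborFinset u ∩ L) : ℝ) ≤
      l * #(G.neighborFinset v \ L) + Fintype.card W * #L := by
    exact_mod_cast sum_card_inter_le_of_disjoint hT hA hAl.le hG sdiff_disjoint
  have h2 : (#(G.neighborFinset v \ L) : ℝ) ≤ G.degree v := by
    exact_mod_cast card_le_card sdiff_subset
  have hm : (0 : ℝ) ≤ Fintype.card W := by positivity
  have hl : (0 : ℝ) ≤ l := by positivity
  nlinarith

/-- Vertices with a large eigenvector entry have large degree. -/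
theorem mul_entry_le_degree (hT : T.IsTree) (hA : ∀ w w', T.Adj w w' → (w ∈ A ↔ w' ∉ A))
    (hAl : #A = l + 1) (hG : T.Free G) (hx0 : ∀ v, 0 ≤ x v)
    (hx1 : ∀ v, x v ≤ 1) (hx : ∀ v, ∑ u ∈ G.neighborFinset v, x u = r * x v)
    (hα : 0 < α) {L : Finset V} (hL : ∀ v ∉ L, x v ≤ α)
    (hLcard : (#L : ℝ) ≤ α * Fintype.card V)
    (hr : l * ((Fintype.card V : ℝ) - l) ≤ r ^ 2)
    (hl : (l : ℝ) ^ 2 ≤ α * Fintype.card W * Fintype.card V) (v : V) :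
    l * Fintype.card V * x v ≤
      l * G.degree v + 6 * α * Fintype.card W * Fintype.card V := by
  have h1 := sq_mul_le hT hG hx0 hx1 hx hα hL hLcard v
  have h2 := sum_card_sdiff_le hT hA hAl hG hLcard v
  have h3 : ∑ u ∈ G.neighborFinset v \ L, ∑ w ∈ G.neighborFinset u ∩ L, x w ≤
      ∑ u ∈ G.neighborFinset v \ L, (#(G.neighborFinset u ∩ L) : ℝ) :=
    sum_le_sum fun u _ => by
      simpa using sum_le_card_nsmul (G.neighborFinset u ∩ L) x 1 fun w _ => hx1 w
  have h4 := mul_le_mul_of_nonneg_right hr (hx0 v)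
  have h5 : (l : ℝ) ^ 2 * x v ≤ l ^ 2 := mul_le_of_le_one_right (sq_nonneg _) (hx1 v)
  nlinarith

/-- At least `l` vertices have an eigenvector entry close to `1`. -/
theorem le_card_entries_near_one (hT : T.IsTree) (hA : ∀ w w', T.Adj w w' → (w ∈ A ↔ w' ∉ A))
    (hAl : #A = l + 1) (hG : T.Free G) (hx0 : ∀ v, 0 ≤ x v)
    (hx1 : ∀ v, x v ≤ 1) {z : V} (hz : x z = 1)
    (hx : ∀ v, ∑ u ∈ G.neighborFinset v, x u = r * x v)
    (hα : 0 < α) {L : Finset V} (hL : ∀ v ∉ L, x v ≤ α)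
    (hLcard : (#L : ℝ) ≤ α * Fintype.card V)
    (hr : l * ((Fintype.card V : ℝ) - l) ≤ r ^ 2)
    (hl : (l : ℝ) ^ 2 ≤ α * Fintype.card W * Fintype.card V)
    (hη : 6 * α * Fintype.card W < η) (hη1 : η ≤ 1) :
    l ≤ #{v | 1 - η ≤ x v} := by
  set L' : Finset V := {v | 1 - η ≤ x v} with hL'
  have : Nonempty V := ⟨z⟩
  have hN : (0 : ℝ) < Fintype.card V := by exact_mod_cast Fintype.card_pos
  have hm : (0 : ℝ) ≤ Fintype.card W := by positivity
  have hη0 : 0 < η := lt_of_le_of_lt (by positivity) hη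
  have h1 := sq_mul_le hT hG hx0 hx1 hx hα hL hLcard z
  rw [hz, mul_one] at h1
  have h2 := sum_card_sdiff_le hT hA hAl hG hLcard z
  have hdeg : (G.degree z : ℝ) ≤ Fintype.card V := by
    exact_mod_cast (G.degree_lt_card_verts z).le
  have h3 : ∀ u, ∑ w ∈ G.neighborFinset u ∩ L, x w ≤
      (1 - η) * #(G.neighborFinset u ∩ L) + η * #(G.neighborFinset u ∩ L') := by
    intro u
    -- Only vertices of `L'` can recover the lost η. Each is reached at most N times, N being the
    -- order of G, and about lN in total is needed, so `L'` has more than l - 1 elements.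
    have hpt : ∀ w, x w ≤ (1 - η) + if w ∈ L' then η else 0 := by
      intro w
      split_ifs with h
      · linarith [hx1 w]
      · simp only [hL', mem_filter, mem_univ, true_and, not_le] at h
        linarith
    refine (sum_le_sum fun w _ => hpt w).trans ?_
    rw [sum_add_distrib, sum_const, nsmul_eq_mul, ← sum_filter, sum_const, nsmul_eq_mul]
    have : (#((G.neighborFinset u ∩ L).filter (· ∈ L')) : ℝ) ≤ #(G.neighborFinset u ∩ L') := by
      refine Nat.cast_le.2 (card_le_card fun w hw => ?_)
      rw [mem_filter, mem_inter] at hw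
      exact mem_inter.2 ⟨hw.1.1, hw.2⟩
    nlinarith
  have h4 := sum_le_sum fun u (_ : u ∈ G.neighborFinset z \ L) => h3 u
  rw [sum_add_distrib, ← mul_sum, ← mul_sum] at h4
  have h5 : ∑ u ∈ G.neighborFinset z \ L, (#(G.neighborFinset u ∩ L') : ℝ) ≤
      #L' * Fintype.card V := by
    have h6 : ∑ u ∈ G.neighborFinset z \ L, #(G.neighborFinset u ∩ L') ≤
        #L' * Fintype.card V := by
      rw [sum_card_inter_comm]
      exact sum_le_card_nsmul _ _ _ fun w _ => card_le_univ _
    exact_mod_cast h6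
  have hl0 : (0 : ℝ) ≤ l := by positivity
  have hld := mul_le_mul_of_nonneg_left hdeg hl0
  have key : (l - 1 : ℝ) * Fintype.card V * η < #L' * Fintype.card V * η := by
    have a1 := mul_le_mul_of_nonneg_left h5 hη0.le
    have a2 := mul_le_mul_of_nonneg_left (h2.trans (add_le_add_left hld _)) (sub_nonneg.2 hη1)
    have a3 := mul_lt_mul_of_pos_right hη hN
    have a4 : 0 ≤ η * (α * Fintype.card W * Fintype.card V) := by positivity
    nlinarith
  have key2 : (l - 1 : ℝ) < #L' := by
    rw [mul_assoc, mul_assoc] at key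
    exact lt_of_mul_lt_mul_right key (by positivity)
  have : (l : ℝ) < (#L' + 1 : ℕ) := by push_cast; linarith
  exact Nat.lt_succ_iff.1 (by exact_mod_cast this)

end Estimates

/-! ### The l dominating vertices -/

section Dominating

variable {V W : Type*} [Fintype V] [Fintype W] {T : SimpleGraph W} {G : SimpleGraph V}
  {A : Finset W} {l : ℕ}

theorem le_card_common_neighbors (S : Finset V) {β : ℝ}
    (hS : ∀ u ∈ S, (1 - β) * Fintype.card V ≤ G.degree u) :
    (1 - #S * β) * Fintype.card V ≤ #{c | ∀ u ∈ S, G.Adj u c} := by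
  have h1 : ({c | ∀ u ∈ S, G.Adj u c} : Finset V)ᶜ ⊆ S.biUnion fun u => (G.neighborFinset u)ᶜ := by
    intro c hc
    simpa using hc
  have h2 := (card_le_card h1).trans card_biUnion_le
  have h3 : ((#({c | ∀ u ∈ S, G.Adj u c} : Finset V)ᶜ : ℕ) : ℝ) ≤
      ∑ u ∈ S, (#(G.neighborFinset u)ᶜ : ℝ) := by exact_mod_cast h2
  have h4 : ∀ B : Finset V, (#Bᶜ : ℝ) = Fintype.card V - #B := fun B => by
    rw [card_compl, Nat.cast_sub (card_le_univ B)]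
  have h5 : ∑ u ∈ S, (#(G.neighborFinset u)ᶜ : ℝ) ≤ #S * (β * Fintype.card V) := by
    rw [← nsmul_eq_mul]
    refine sum_le_card_nsmul _ _ _ fun u hu => ?_
    rw [h4, SimpleGraph.card_neighborFinset_eq_degree]
    linarith [hS u hu]
  rw [h4] at h3
  linarith

/-- Hypothesis `h1` makes the common neighbourhood of any l + 1 near-maximal vertices at least half
the graph, which would embed T. Hypothesis `h4` says that 2m entries from outside L weigh less than
a single entry of L, so rewiring pays. -/
theorem forall_adj_of_estimates (hT : T.IsTree) (hA : ∀ w w', T.Adj w w' → (w ∈ A ↔ w' ∉ A))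
    (hAl : #A = l + 1) (hl : 1 ≤ l) (hG : T.Free G)
    (hmax : ∀ G' : SimpleGraph V, T.Free G' → lambda G' ≤ lambda G) {x : V → ℝ}
    (hx0 : ∀ v, 0 ≤ x v) (hx : ∀ v, ∑ u ∈ G.neighborFinset v, x u = lambda G * x v)
    {κ η : ℝ} (hκ : 0 < κ) (hη : 0 < η)
    (hdeg : ∀ v, l * Fintype.card V * x v ≤ l * G.degree v + κ * Fintype.card V)
    (hlarge : l ≤ #{v | 1 - η ≤ x v})
    (h1 : (l + 1) * (η + κ) ≤ 1 / 2) (h2 : 4 * Fintype.card W ≤ Fintype.card V)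
    (h3 : (l + Fintype.card W : ℝ) ≤ κ * Fintype.card V)
    (h4 : 2 * Fintype.card W * (2 * κ + l * (η + κ)) < 1 - η) :
    ∃ L : Finset V, #L = l ∧ ∀ u ∈ L, ∀ v ∉ L, G.Adj u v := by
  obtain ⟨a, ha⟩ : A.Nonempty := card_pos.1 (by omega)
  have hm : 0 < Fintype.card W := Fintype.card_pos_iff.2 ⟨a⟩
  have : Nonempty V := Fintype.card_pos_iff.1 (by omega)
  have hN : (0 : ℝ) < Fintype.card V := by exact_mod_cast Fintype.card_pos
  have hl' : (1 : ℝ) ≤ l := by exact_mod_cast hl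
  have h2' : (4 * Fintype.card W : ℝ) ≤ Fintype.card V := by exact_mod_cast h2
  have hentry : ∀ v, Fintype.card V * x v ≤ G.degree v + κ * Fintype.card V := by
    intro v
    have h := hdeg v
    have h' : κ * Fintype.card V ≤ l * (κ * Fintype.card V) :=
      le_mul_of_one_le_left (by positivity) hl'
    exact le_of_mul_le_mul_left (by linarith : (l : ℝ) * (Fintype.card V * x v) ≤
      l * (G.degree v + κ * Fintype.card V)) (by linarith)
  set L : Finset V := {v | 1 - η ≤ x v} with hLdef
  have hLx : ∀ u ∈ L, 1 - η ≤ x u := fun u hu => (mem_filter.1 hu).2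
  have hLdeg : ∀ u ∈ L, (1 - (η + κ)) * Fintype.card V ≤ G.degree u := by
    intro u hu
    have := hentry u
    have := mul_le_mul_of_nonneg_left (hLx u hu) hN.le
    linarith
  have hLl : #L = l := by
    refine le_antisymm (not_lt.1 fun hlt => ?_) hlarge
    obtain ⟨L', hL', hL'card⟩ := exists_subset_card_eq (Nat.succ_le_of_lt hlt)
    have hc := le_card_common_neighbors (G := G) L' fun u hu => hLdeg u (hL' hu)
    rw [hL'card] at hc
    set C : Finset V := {c | ∀ u ∈ L', G.Adj u c} with hC
    have hCadj : ∀ c ∈ C, ∀ u ∈ L', G.Adj u c := fun c hc => (mem_filter.1 hc).2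
    have hCm : Fintype.card W ≤ #C := by
      push_cast at hc
      have : (Fintype.card W : ℝ) ≤ #C := by nlinarith
      exact_mod_cast this
    refine hG (isContained_of_bipartite hT hA hAl.le (X := C) (Y := L') ?_
      (card_pos.1 (by omega)) (card_pos.1 (by omega)) (fun c hc => ?_) fun u hu => ?_)
    · rw [disjoint_left]
      exact fun c hc hcL => (hCadj c hc c hcL).ne rfl
    · rw [inter_eq_right.2 fun u hu => by simpa using (hCadj c hc u hu).symm]
      omega
    · rwa [inter_eq_right.2 fun c hc => by simpa using hCadj c hc u hu]
  refine ⟨L, hLl, ?_⟩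
  have hc := le_card_common_neighbors (G := G) L hLdeg
  rw [hLl] at hc
  set C : Finset V := {c | ∀ u ∈ L, G.Adj u c} with hC
  have hCadj : ∀ u ∈ L, ∀ c ∈ C, G.Adj u c := fun u hu c hc => (mem_filter.1 hc).2 u hu
  have hC2 : 2 * Fintype.card W ≤ #C := by
    have : (2 * Fintype.card W : ℝ) ≤ #C := by nlinarith
    exact_mod_cast this
  have hCnbr : ∀ v ∉ L, #(G.neighborFinset v ∩ C) < Fintype.card W := fun v hv =>
    (card_neighbors_lt hT hA hAl ha hG hLl hCadj hC2 hv).trans (T.degree_lt_card_verts a)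
  -- E collects the vertices outside L that miss some vertex of L; the goal is to show that it is
  -- empty.
  set E : Finset V := (L ∪ C)ᶜ with hE
  have hEcard : (#E : ℝ) ≤ l * (η + κ) * Fintype.card V := by
    have hh1 : #E ≤ #Cᶜ := card_le_card (compl_subset_compl.2 subset_union_right)
    have hh2 : (#Cᶜ : ℝ) = Fintype.card V - #C := by
      rw [card_compl, Nat.cast_sub (card_le_univ C)]
    have hh3 : (#E : ℝ) ≤ #Cᶜ := by exact_mod_cast hh1
    linarith
  have hsplit : ∀ v, G.neighborFinset v \ L ⊆ (G.neighborFinset v ∩ C) ∪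
      (G.neighborFinset v ∩ E) := by
    intro v u hu
    simp only [mem_sdiff, mem_union, mem_inter, hE, mem_compl] at hu ⊢
    tauto
  have hsplit' : ∀ v, #(G.neighborFinset v \ L) ≤ #(G.neighborFinset v ∩ C) +
      #(G.neighborFinset v ∩ E) := fun v =>
    (card_le_card (hsplit v)).trans (card_union_le _ _)
  have hsmall : ∀ v ∉ L, x v ≤ 2 * κ + l * (η + κ) := by
    intro v hv
    have hd : G.degree v ≤ l + (Fintype.card W + #E) := by
      have a1 := card_inter_add_card_sdiff (G.neighborFinset v) L
      rw [SimpleGraph.card_neighborFinset_eq_degree] at a1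
      have a2 : #(G.neighborFinset v ∩ L) ≤ l := hLl ▸ card_le_card inter_subset_right
      have a3 : #(G.neighborFinset v ∩ E) ≤ #E := card_le_card inter_subset_right
      have a4 := hsplit' v
      have a5 := hCnbr v hv
      omega
    have hd' : (G.degree v : ℝ) ≤ l + (Fintype.card W + #E) := by exact_mod_cast hd
    have := hentry v
    exact le_of_mul_le_mul_left (by linarith : (Fintype.card V : ℝ) * x v ≤
      Fintype.card V * (2 * κ + l * (η + κ))) hN
  suffices hempty : E = ∅ by
    intro u hu v hv
    have hvE : v ∉ E := by simp [hempty]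
    simp only [hE, mem_compl, mem_union, not_not] at hvE
    exact hCadj u hu v (hvE.resolve_left hv)
  by_contra hne
  obtain ⟨v, hvE, hvlt⟩ := exists_card_inter_lt hT hG (nonempty_iff_ne_empty.2 hne)
  have hvE' := hvE
  simp only [hE, mem_compl, mem_union, not_or] at hvE'
  obtain ⟨hvL, hvC⟩ := hvE'
  obtain ⟨u, huL, huv⟩ : ∃ u ∈ L, ¬ G.Adj u v := by
    by_contra! hcon
    exact hvC (mem_filter.2 ⟨mem_univ _, hcon⟩)
  -- Outside L, v has fewer than m neighbours in C and fewer than m in E, all with small entries;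
  -- together they weigh less than the missing neighbour u.
  have hgain : lambda G * x v < ∑ w ∈ L, x w := by
    rw [← hx v, ← sum_inter_add_sum_sdiff (G.neighborFinset v) L]
    have hb1 : ∑ w ∈ G.neighborFinset v \ L, x w ≤
        #(G.neighborFinset v \ L) * (2 * κ + l * (η + κ)) := by
      rw [← nsmul_eq_mul]
      exact sum_le_card_nsmul _ _ _ fun w hw => hsmall w (mem_sdiff.1 hw).2
    have hb2 : (#(G.neighborFinset v \ L) : ℝ) ≤ 2 * Fintype.card W := by
      have a4 := hsplit' v
      have a5 := hCnbr v hvL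
      exact_mod_cast (by omega : #(G.neighborFinset v \ L) ≤ 2 * Fintype.card W)
    have hb3 := mul_le_mul_of_nonneg_right hb2
      (by positivity : 0 ≤ 2 * κ + l * (η + κ))
    have hb4 : ∑ w ∈ G.neighborFinset v ∩ L, x w + x u ≤ ∑ w ∈ L, x w := by
      have hu : u ∉ G.neighborFinset v ∩ L := by
        simp [G.adj_comm v u, huv]
      rw [add_comm, ← sum_insert hu]
      exact sum_le_sum_of_subset_of_nonneg (insert_subset huL inter_subset_right)
        fun w _ _ => hx0 w
    linarith [hLx u huL]
  exact (hmax _ (free_rewire hG hvL hCadj (by omega) hvC)).not_gt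
    (lambda_lt_lambda_rewire hx0 hx hvL hgain)

/-- The test vector is √N on the l-side and √l on the other. -/
theorem sqrt_mul_le_lambda_completeBipartiteGraph (N : ℕ) (h : 1 ≤ l) (hN : 1 ≤ N) :
    Real.sqrt (l * N) ≤ lambda (completeBipartiteGraph (Fin l) (Fin N)) := by
  have : Nonempty (Fin l) := ⟨⟨0, h⟩⟩
  have hl0 : (0 : ℝ) < l := by exact_mod_cast h
  have hN0 : (0 : ℝ) < N := by exact_mod_cast hN
  set p := Real.sqrt l with hp
  set q := Real.sqrt N with hq
  have hp2 : p ^ 2 = l := Real.sq_sqrt hl0.le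
  have hq2 : q ^ 2 = N := Real.sq_sqrt hN0.le
  have hr := rayleigh_le (completeBipartiteGraph (Fin l) (Fin N))
    (Sum.elim (fun _ => q) (fun _ => p))
  simp only [SimpleGraph.neighborFinset_eq_filter, sum_filter, Fintype.sum_sum_type] at hr
  simp [hp2, hq2] at hr
  rw [Real.sqrt_mul hl0.le, ← hp, ← hq]
  have hpos : (0 : ℝ) < l * N := by positivity
  rw [← hp2, ← hq2] at hr hpos
  exact le_of_mul_le_mul_right (by linarith : p * q * (p ^ 2 * q ^ 2) ≤ _ * (p ^ 2 * q ^ 2)) hpos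

/-- In extremal graphs of large order some `l` vertices are adjacent to all others. -/
theorem exists_dominating_set (hT : T.IsTree) (hA : ∀ w w', T.Adj w w' → (w ∈ A ↔ w' ∉ A))
    (hAl : #A = l + 1) (hAc : #A ≤ #Aᶜ) (hl : 1 ≤ l) :
    ∃ N : ℕ, ∀ n, N < n → ∀ G ∈ SPEX n T,
      ∃ L : Finset (Fin n), #L = l ∧ ∀ u ∈ L, ∀ v ∉ L, G.Adj u v := by
  have hmN : 2 * (l + 1) ≤ Fintype.card W := by
    have := card_add_card_compl A
    omega
  have hm : (2 * (l + 1) : ℝ) ≤ Fintype.card W := by exact_mod_cast hmN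
  have hl' : (1 : ℝ) ≤ l := by exact_mod_cast hl
  set m : ℝ := ((Fintype.card W : ℕ) : ℝ) with hmdef
  have hm4 : 4 ≤ m := by linarith
  -- The order m⁻² is forced by the final estimate, where 2m · l · η with l < m/2 must stay below 1.
  -- Then α is chosen so that the error 6αm equals κ = η/4.
  obtain ⟨η, hη⟩ : ∃ η : ℝ, η = 1 / (8 * m ^ 2) := ⟨_, rfl⟩
  have hη0 : 0 < η := by rw [hη]; positivity
  have hηm : η * m ^ 2 = 1 / 8 := by rw [hη]; field_simp
  have hηm1 : η * m ≤ 1 / 32 := by nlinarith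
  have hη1 : η ≤ 1 / 128 := by nlinarith
  obtain ⟨α, hα⟩ : ∃ α : ℝ, α = η / (24 * m) := ⟨_, rfl⟩
  have hα0 : 0 < α := by rw [hα]; positivity
  have hαm : 6 * α * m = η / 4 := by rw [hα]; field_simp; norm_num
  have hα1 : α ≤ 1 / 2 := by nlinarith
  -- Each summand serves one condition; the squared one gives r ≥ √(l(n-l)) ≥ 2m/α², as required for
  -- counting large entries.
  obtain ⟨N, hN⟩ := exists_nat_gt ((l : ℝ) ^ 2 / (α * m) + (l + m) / (η / 4) + 4 * m +
    (2 * m / α ^ 2) ^ 2 + l + 1)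
  refine ⟨N, fun n hn G hG => ?_⟩
  have hn' : (l : ℝ) ^ 2 / (α * m) + (l + m) / (η / 4) + 4 * m +
    (2 * m / α ^ 2) ^ 2 + l + 1 < n := hN.trans (by exact_mod_cast hn)
  have p1 : 0 ≤ (l : ℝ) ^ 2 / (α * m) := by positivity
  have p2 : 0 ≤ (l + m) / (η / 4) := by positivity
  have p3 : 0 ≤ (2 * m / α ^ 2) ^ 2 := sq_nonneg _
  have q1 : (l : ℝ) ^ 2 ≤ α * m * n := by
    have : (l : ℝ) ^ 2 / (α * m) ≤ n := by linarith
    rw [div_le_iff₀ (by positivity)] at this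
    linarith
  have q2 : l + m ≤ η / 4 * n := by
    have : (l + m) / (η / 4) ≤ n := by linarith
    rw [div_le_iff₀ (by positivity)] at this
    linarith
  have q3 : 4 * m ≤ n := by linarith
  have q4 : (2 * m / α ^ 2) ^ 2 ≤ n - l := by linarith
  have q5 : (l : ℝ) + 1 < n := by linarith
  have hln : l + 1 < n := by exact_mod_cast q5
  have : Nonempty (Fin n) := ⟨⟨0, by omega⟩⟩
  have hmax : ∀ G' : SimpleGraph (Fin n), T.Free G' → lambda G' ≤ lambda G := fun G' h =>
    hG.2 ▸ lambda_le_spex h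
  have hsq : Real.sqrt (l * (n - l : ℕ)) ≤ lambda G :=
    (sqrt_mul_le_lambda_completeBipartiteGraph (n - l) hl (by omega)).trans
      (hG.2 ▸ lambda_le_spex_of_card (by simp; omega)
        (free_completeBipartiteGraph hT hA hAl hAc (n - l)))
  rw [Nat.cast_sub (by omega)] at hsq
  have hnl : (0 : ℝ) < n - l := by linarith
  have hr2 : (l : ℝ) * (n - l) ≤ lambda G ^ 2 := (Real.sqrt_le_iff.1 hsq).2
  have hr1 : 2 * m / α ^ 2 ≤ lambda G := by
    refine le_trans (Real.le_sqrt_of_sq_le ?_) hsq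
    nlinarith
  have hr0 : 0 < lambda G := lt_of_lt_of_le (by positivity) hr1
  obtain ⟨x, hx0, hx1, ⟨z, hz⟩, hx⟩ := exists_perron_vector G
  have hcard : (Fintype.card (Fin n) : ℝ) = n := by simp
  have hLcard := card_large_entries_le hT hG.1 hx1 hx hr0 hα0 (by
    rw [div_le_iff₀ (by positivity)] at hr1
    linarith)
  have hL : ∀ v ∉ ({v | α ≤ x v} : Finset (Fin n)), x v ≤ α := fun v hv => by
    simp only [mem_filter, mem_univ, true_and, not_le] at hv
    exact hv.le
  have e1 := mul_entry_le_degree hT hA hAl hG.1 hx0 hx1 hx hα0 hL hLcard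
    (by rwa [hcard]) (by rwa [hcard])
  have e2 := le_card_entries_near_one (η := η) hT hA hAl hG.1 hx0 hx1 hz hx hα0 hL hLcard
    (by rwa [hcard]) (by rwa [hcard]) (by linarith) (by linarith)
  rw [← hmdef, hαm] at e1
  refine forall_adj_of_estimates hT hA hAl hl hG.1 hmax hx0 hx (κ := η / 4) (by positivity) hη0
    e1 e2 ?_ ?_ ?_ ?_
  · nlinarith
  · rw [Fintype.card_fin]
    rw [hmdef] at q3
    exact_mod_cast q3
  · rwa [hcard]
  · rw [← hmdef]
    nlinarith

end Dominating

/-! ### Nearly regular graphs -/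

section NearRegular

/-- Cayley graph of ℤ/N with connection set ±1, …, ±K. Adjacency of consecutive residues is kept for
deleting a matching later. -/
theorem exists_circulant {N K : ℕ} [NeZero N] (h : 2 * K < N) :
    ∃ G : SimpleGraph (ZMod N), (∀ v, G.degree v = 2 * K) ∧
      (1 ≤ K → ∀ u v, v - u = 1 → G.Adj u v) := by
  let S : Finset (ZMod N) := ((Icc (-K : ℤ) K).erase 0).image (Int.cast)
  have hinj : Set.InjOn (Int.cast : ℤ → ZMod N) (Icc (-K : ℤ) K) := by
    intro a ha b hb hab
    rw [coe_Icc, Set.mem_Icc] at ha hb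
    rw [ZMod.intCast_eq_intCast_iff_dvd_sub] at hab
    have := Int.eq_zero_of_abs_lt_dvd hab (by rw [abs_lt]; constructor <;> omega)
    omega
  have hScard : #S = 2 * K := by
    rw [card_image_of_injOn (hinj.mono (by simp)), card_erase_of_mem (by simp), Int.card_Icc]
    omega
  have hSneg : ∀ s ∈ S, -s ∈ S := by
    intro s hs
    obtain ⟨a, ha, rfl⟩ := mem_image.1 hs
    rw [mem_erase, mem_Icc] at ha
    exact mem_image.2 ⟨-a, by rw [mem_erase, mem_Icc]; omega, by push_cast; rfl⟩
  have hS0 : (0 : ZMod N) ∉ S := by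
    intro hs
    obtain ⟨a, ha, ha0⟩ := mem_image.1 hs
    rw [mem_erase] at ha
    exact ha.1 (hinj (mem_coe.2 ha.2) (by simp) (by simpa using ha0))
  refine ⟨⟨fun u v => v - u ∈ S, ⟨fun u v h => by simpa using hSneg _ h⟩,
    ⟨fun u h => hS0 (by simpa using h)⟩⟩, fun v => ?_, fun hK u v huv => ?_⟩
  · rw [← SimpleGraph.card_neighborFinset_eq_degree, ← hScard,
      ← card_image_of_injective S (add_right_injective v)]
    congr 1
    ext u
    rw [SimpleGraph.mem_neighborFinset]
    refine Iff.trans (b := u - v ∈ S) Iff.rfl (Iff.trans ?_ mem_image.symm)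
    exact ⟨fun h => ⟨u - v, h, by simp⟩, fun ⟨s, hs, h⟩ => by simpa [← h] using hs⟩
  · change v - u ∈ S
    rw [huv]
    exact mem_image.2 ⟨1, by rw [mem_erase, mem_Icc]; omega, by simp⟩

/-- On every large vertex set there is a graph all of whose degrees are `d`, except possibly for
one vertex of degree `d + 1`. -/
theorem exists_near_regular {N d : ℕ} [NeZero N] (h : d + 1 < N) :
    ∃ G : SimpleGraph (ZMod N), (∀ v, d ≤ G.degree v ∧ G.degree v ≤ d + 1) ∧
      #{v | G.degree v = d + 1} ≤ 1 := by
  obtain ⟨k, rfl | rfl⟩ := Nat.even_or_odd' d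
  · obtain ⟨G, hG, -⟩ := exists_circulant (N := N) (K := k) (by omega)
    exact ⟨G, fun v => by rw [hG v]; omega, by simp [hG]⟩
  obtain ⟨G, hG, hadj⟩ := exists_circulant (N := N) (K := k + 1) (by omega)
  replace hadj := hadj (by omega)
  -- For odd d, delete the matching of pairs {2j, 2j + 1} from the (d + 1)-regular circulant. Only
  -- the residue N - 1 can be unmatched.
  obtain ⟨H, hHadj⟩ : ∃ H : SimpleGraph (ZMod N),
      ∀ u v, H.Adj u v ↔ G.Adj u v ∧ v.val / 2 ≠ u.val / 2 :=
    ⟨⟨fun u v => G.Adj u v ∧ v.val / 2 ≠ u.val / 2, ⟨fun u v h => ⟨h.1.symm, h.2.symm⟩⟩,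
      ⟨fun u h => h.2 rfl⟩⟩, fun _ _ => Iff.rfl⟩
  have hH : ∀ u, H.neighborFinset u =
      (G.neighborFinset u).filter fun v => v.val / 2 ≠ u.val / 2 := by
    intro u; ext v; simp [hHadj]
  have hsum : ∀ u, H.degree u +
      #((G.neighborFinset u).filter fun v => v.val / 2 = u.val / 2) = 2 * (k + 1) := by
    intro u
    rw [← hG u, ← SimpleGraph.card_neighborFinset_eq_degree, hH,
      ← SimpleGraph.card_neighborFinset_eq_degree, add_comm]
    exact card_filter_add_card_filter_not _
  have hle : ∀ u, #((G.neighborFinset u).filter fun v => v.val / 2 = u.val / 2) ≤ 1 := by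
    intro u
    refine card_le_one.2 fun v hv w hw => ?_
    simp only [mem_filter, SimpleGraph.mem_neighborFinset] at hv hw
    have h1 : v.val ≠ u.val := fun h => hv.1.ne' (ZMod.val_injective N h)
    have h2 : w.val ≠ u.val := fun h => hw.1.ne' (ZMod.val_injective N h)
    exact ZMod.val_injective N (by omega)
  have hge : ∀ u : ZMod N, u.val + 1 ≠ N →
      0 < #((G.neighborFinset u).filter fun v => v.val / 2 = u.val / 2) := by
    intro u hu
    have hlt := ZMod.val_lt u
    have huv : ((u.val : ℕ) : ZMod N) = u := ZMod.natCast_zmod_val u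
    rw [card_pos]
    rcases Nat.even_or_odd' u.val with ⟨j, hj | hj⟩
    · refine ⟨((u.val + 1 : ℕ) : ZMod N), ?_⟩
      rw [mem_filter, SimpleGraph.mem_neighborFinset, ZMod.val_natCast_of_lt (by omega)]
      exact ⟨hadj _ _ (by push_cast; rw [huv]; ring), by omega⟩
    · refine ⟨((u.val - 1 : ℕ) : ZMod N), ?_⟩
      rw [mem_filter, SimpleGraph.mem_neighborFinset, ZMod.val_natCast_of_lt (by omega)]
      refine ⟨(hadj _ _ ?_).symm, by omega⟩
      rw [Nat.cast_sub (by omega), huv]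
      push_cast
      ring
  refine ⟨H, fun v => ?_, card_le_one.2 fun v hv w hw => ?_⟩
  · have := hsum v
    have := hle v
    omega
  · rw [mem_filter] at hv hw
    have h1 := hsum v
    have h2 := hsum w
    have h3 := hge v
    have h4 := hge w
    exact ZMod.val_injective N (by omega)

end NearRegular

/-! ### Comparing joins with the quotient matrix -/

section Quotient

variable {l n : ℕ} {d : ℝ}

theorem f_spec (h : l ≤ n) :
    d ≤ f l d n ∧ (l : ℝ) - 1 ≤ f l d n ∧
      (f l d n - (l - 1)) * (f l d n - d) = l * ((n : ℝ) - l) := by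
  have h1 : (0 : ℝ) ≤ l * ((n : ℝ) - l) :=
    mul_nonneg (Nat.cast_nonneg l) (sub_nonneg.2 (by exact_mod_cast h))
  have hD : ((l : ℝ) + d - 1) ^ 2 + 4 * ((n : ℝ) * l + d - l * d - (l : ℝ) ^ 2) =
      (d - l + 1) ^ 2 + 4 * (l * ((n : ℝ) - l)) := by ring
  unfold f
  rw [hD]
  set D := (d - l + 1) ^ 2 + 4 * (l * ((n : ℝ) - l)) with hDdef
  have hD0 : 0 ≤ D := by positivity
  have hsq := Real.sq_sqrt hD0
  have habs : |d - l + 1| ≤ Real.sqrt D := Real.abs_le_sqrt (by linarith)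
  rw [abs_le] at habs
  refine ⟨by linarith [habs.2], by linarith [habs.1], ?_⟩
  nlinarith

/-- The quotient eigenvector of the join. -/
theorem exists_quotient_vector (h : l < n) (hd : 0 ≤ d) :
    ∃ a : ℝ, 0 < a ∧ l * a + d = f l d n ∧
      (1 ≤ l → ((l : ℝ) - 1) * a + ((n : ℝ) - l) = f l d n * a) := by
  obtain ⟨h1, h2, h3⟩ := f_spec (d := d) h.le
  rcases Nat.eq_zero_or_pos l with rfl | hl
  -- For l = 0 there is no clique side: f equals d and the value of a is arbitrary.
  · refine ⟨1, one_pos, ?_, fun h => absurd h (by norm_num)⟩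
    simp only [Nat.cast_zero, zero_mul, mul_eq_zero] at h3
    rcases h3 with h3 | h3 <;> simp <;> linarith
  · have hl0 : (0 : ℝ) < l := by exact_mod_cast hl
    have hn0 : (0 : ℝ) < (n : ℝ) - l := sub_pos.2 (by exact_mod_cast h)
    have hpos : 0 < f l d n - d := by
      refine lt_of_le_of_ne (by linarith) fun h0 => ?_
      rw [← h0, mul_zero] at h3
      exact (mul_pos hl0 hn0).ne h3
    refine ⟨(f l d n - d) / l, by positivity, by field_simp; ring, fun _ => ?_⟩
    field_simp
    linarith

variable {V : Type*} [Fintype V]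

/-- Collatz–Wielandt with the vector a on the l-side and 1 elsewhere: missing edges only lower its
row sums. -/
theorem lambda_join_le (H₁ : SimpleGraph (Fin l)) (H₂ : SimpleGraph V) [Nonempty V]
    (hn : n = l + Fintype.card V) {d : ℕ} (hd : ∀ v, H₂.degree v ≤ d) :
    lambda (join H₁ H₂) ≤ f l d n := by
  have hV : 0 < Fintype.card V := Fintype.card_pos
  obtain ⟨a, ha, h1, h2⟩ := exists_quotient_vector (l := l) (n := n) (d := d) (by omega)
    (Nat.cast_nonneg d)
  have hn' : (n : ℝ) - l = Fintype.card V := by rw [hn]; push_cast; ring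
  refine lambda_le_of_pos _ (Sum.elim (fun _ => a) fun _ => 1) _ ?_ ?_
  · rintro (i | i) <;> simp [ha]
  · rintro (i | i)
    · have hl : 1 ≤ l := i.pos
      have hdeg : (H₁.degree i : ℝ) ≤ l - 1 := by
        have := H₁.degree_lt_card_verts i
        rw [Fintype.card_fin] at this
        rw [le_sub_iff_add_le]
        exact_mod_cast this
      rw [sum_neighborFinset_join_inl]
      simp only [Sum.elim_inl, Sum.elim_inr, sum_const, nsmul_eq_mul, mul_one, card_univ,
        SimpleGraph.card_neighborFinset_eq_degree]
      have := mul_le_mul_of_nonneg_right hdeg ha.le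
      linarith [h2 hl]
    · have hdeg : (H₂.degree i : ℝ) ≤ d := by exact_mod_cast hd i
      rw [sum_neighborFinset_join_inr]
      simp only [Sum.elim_inl, Sum.elim_inr, sum_const, nsmul_eq_mul, mul_one, card_univ,
        SimpleGraph.card_neighborFinset_eq_degree, Fintype.card_fin]
      linarith

/-- The same vector in the Rayleigh bound: additional edges in H only raise its row sums. -/
theorem le_lambda_join_top (H : SimpleGraph V) [Nonempty V]
    (hn : n = l + Fintype.card V) {d : ℕ} (hd : ∀ v, d ≤ H.degree v) :
    f l d n ≤ lambda (join (⊤ : SimpleGraph (Fin l)) H) := by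
  have hV : 0 < Fintype.card V := Fintype.card_pos
  obtain ⟨a, ha, h1, h2⟩ := exists_quotient_vector (l := l) (n := n) (d := d) (by omega)
    (Nat.cast_nonneg d)
  have hn' : (n : ℝ) - l = Fintype.card V := by rw [hn]; push_cast; ring
  set y : Fin l ⊕ V → ℝ := Sum.elim (fun _ => a) fun _ => 1 with hy
  have hy0 : ∀ v, 0 ≤ y v := by rintro (i | i) <;> simp [hy, ha.le]
  have hrow : ∀ v, f l d n * y v ≤
      ∑ u ∈ (join (⊤ : SimpleGraph (Fin l)) H).neighborFinset v, y u := by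
    rintro (i | i)
    · have hl : 1 ≤ l := i.pos
      have hdeg : ∀ inst : Fintype ((⊤ : SimpleGraph (Fin l)).neighborSet i),
          @SimpleGraph.degree _ ⊤ i inst = l - 1 := fun inst => by
        convert SimpleGraph.complete_graph_degree i
        simp
      rw [sum_neighborFinset_join_inl]
      simp only [hy, Sum.elim_inl, Sum.elim_inr, sum_const, nsmul_eq_mul, mul_one, card_univ,
        SimpleGraph.card_neighborFinset_eq_degree, hdeg, Nat.cast_sub hl, Nat.cast_one]
      linarith [h2 hl]
    · have hdeg : (d : ℝ) ≤ H.degree i := by exact_mod_cast hd i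
      rw [sum_neighborFinset_join_inr]
      simp only [hy, Sum.elim_inl, Sum.elim_inr, sum_const, nsmul_eq_mul, mul_one, card_univ,
        SimpleGraph.card_neighborFinset_eq_degree, Fintype.card_fin]
      linarith
  have hpos : 0 < ∑ v, y v ^ 2 :=
    sum_pos' (fun v _ => sq_nonneg _) ⟨Sum.inr (Classical.arbitrary V), mem_univ _, by simp [hy]⟩
  refine le_of_mul_le_mul_right (le_trans ?_ (rayleigh_le _ y)) hpos
  rw [mul_sum]
  refine sum_le_sum fun v _ => ?_
  have := mul_le_mul_of_nonneg_left (hrow v) (hy0 v)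
  linarith

end Quotient

end SpectralTuran

/-! ### The main theorem -/

open SpectralTuran

theorem theorem1p6 {W : Type*} [Fintype W] (T : SimpleGraph W) (m l δ : ℕ)
    (hT : SpectralTuran.InTreeFamily T m l δ) :
    ∃ N : ℕ, ∀ n : ℕ, N < n →
      (∀ G ∈ SpectralTuran.SPEX n T,
        (∃ (H₁ : SimpleGraph (Fin l)) (H₂ : SimpleGraph (Fin (n - l))),
          Nonempty (G ≃g SpectralTuran.join H₁ H₂) ∧ H₂.maxDegree ≤ δ - 1) ∧
        (∀ H₂' : SimpleGraph (Fin (n - l)),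
          H₂'.maxDegree ≤ δ - 1 →
          (Finset.univ.filter fun v => H₂'.degree v = δ - 1).card ≤ 1 →
          SpectralTuran.lambda (SpectralTuran.join (⊤ : SimpleGraph (Fin l)) H₂') ≤
            SpectralTuran.lambda G)) ∧
      (2 ≤ δ → SpectralTuran.f l ((δ : ℝ) - 2) n ≤ SpectralTuran.spex n T) ∧
      SpectralTuran.spex n T ≤ SpectralTuran.f l ((δ : ℝ) - 1) n := by
  obtain ⟨A, hbip, hAl, hAc, ⟨a, ha, haδ⟩, hmin⟩ := hT.exists_smaller_part
  have htree := hT.isTree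
  have hA : ∀ w w', T.Adj w w' → (w ∈ A ↔ w' ∉ A) := by
    intro w w' h
    have := hbip.mem_of_adj h
    simp only [Finset.coe_compl, Set.mem_compl_iff, Finset.mem_coe] at this
    tauto
  have hδ : ∀ w ∈ A, δ ≤ T.degree w := fun w hw => hmin ⟨w, hw, rfl⟩
  have hne : Nontrivial W := by
    obtain ⟨b, hb⟩ : (Aᶜ).Nonempty := Finset.card_pos.1 (by omega)
    exact ⟨a, b, fun h => (Finset.mem_compl.1 hb) (h ▸ ha)⟩
  have hδ1 : 1 ≤ δ := by
    rw [← haδ, Nat.one_le_iff_ne_zero, ← Nat.pos_iff_ne_zero]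
    exact htree.connected.preconnected.degree_pos_of_nontrivial a
  have hbot : T ≠ ⊥ := by
    rintro rfl
    simp at haδ
    omega
  obtain ⟨N₀, hN₀⟩ : ∃ N : ℕ, ∀ n, N < n → ∀ G ∈ SPEX n T,
      ∃ L : Finset (Fin n), L.card = l ∧ ∀ u ∈ L, ∀ v ∉ L, G.Adj u v := by
    rcases Nat.eq_zero_or_pos l with rfl | hl
    -- For l = 0 the tree is a star and the empty set dominates vacuously.
    · exact ⟨0, fun n _ G _ => ⟨∅, rfl, by simp⟩⟩
    · exact exists_dominating_set htree hA hAl hAc hl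
  -- Room for 2m vertices outside L in `card_neighbors_lt`, and for a nearly (δ - 2)-regular graph
  -- on n - l vertices.
  refine ⟨N₀ + l + 2 * Fintype.card W + δ, fun n hn => ?_⟩
  have key : ∀ G ∈ SPEX n T, ∃ (H₁ : SimpleGraph (Fin l)) (H₂ : SimpleGraph (Fin (n - l))),
      Nonempty (G ≃g join H₁ H₂) ∧ H₂.maxDegree ≤ δ - 1 := by
    intro G hG
    obtain ⟨L, hL, hadj⟩ := hN₀ n (by omega) G hG
    refine exists_iso_join hL hadj fun v hv => ?_
    refine Nat.le_sub_one_of_lt (haδ ▸ ?_)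
    convert card_neighbors_lt htree hA hAl ha hG.1 hL (C := Lᶜ)
      (fun u hu c hc => hadj u hu c (Finset.mem_compl.1 hc))
      (by rw [Finset.card_compl, hL, Fintype.card_fin]; omega) hv
  refine ⟨fun G hG => ⟨key G hG, fun H hH hH1 => ?_⟩, fun hδ2 => ?_, ?_⟩
  · rw [hG.2]
    refine lambda_le_spex_of_card (by simp; omega)
      (free_join_top htree hA hAl hδ hδ1 H (fun v => (H.degree_le_maxDegree v).trans hH) ?_)
    convert hH1
  · have : NeZero (n - l) := ⟨by omega⟩
    obtain ⟨H, hH, hH1⟩ := exists_near_regular (N := n - l) (d := δ - 2) (by omega)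
    have hfree := free_join_top htree hA hAl hδ hδ1 H
      (fun v => by have := (hH v).2; omega) (by
        rwa [show δ - 1 = δ - 2 + 1 by omega])
    have hle := le_lambda_join_top (l := l) (n := n) H (by rw [ZMod.card]; omega)
      (fun v => (hH v).1)
    rw [Nat.cast_sub hδ2] at hle
    exact hle.trans (lambda_le_spex_of_card (by simp [ZMod.card]; omega) hfree)
  · obtain ⟨G, hG⟩ := exists_mem_SPEX hbot n
    obtain ⟨H₁, H₂, ⟨e⟩, hd⟩ := key G hG
    have : Nonempty (Fin (n - l)) := ⟨⟨0, by omega⟩⟩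
    have hle := lambda_join_le (n := n) H₁ H₂ (by rw [Fintype.card_fin]; omega)
      (fun v => (H₂.degree_le_maxDegree v).trans hd)
    rw [Nat.cast_sub hδ1, Nat.cast_one] at hle
    rwa [← hG.2, lambda_congr e]
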